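/- **Setting.** Let $M$ be a smooth Hausdorff paracompact 3-manifold. Let $\tau_k=-\tfrac{i}{2}\sigma_k$ ($k=0,1,2$), and let $\mathfrak{so}(4)\cong\mathfrak{su}(2)\oplus\mathfrak{su}(2)$ have the generators $L_k=(\tau_k,\tau_k)$, $Q_k=(\tau_k,-\tau_k)$, so that $[L_i,L_j]=\epsilon_{ijk}L^k$, $[L_i,Q_j]=\epsilon_{ijk}Q^k$, $[Q_i,Q_j]=\epsilon_{ijk}L^k$, with the invariant form $\mathrm{Tr}(L_iL_j)=\mathrm{Tr}(Q_iQ_j)=0$, $\mathrm{Tr}(L_iQ_j)=\delta_{ij}$. The gauge group "$SO(4)\equiv SU(2)\times S(3)$" is the group $\mathbb G=SU(2)\times SU(2)$ (locally isomorphic to $SO(4)$), with stability subgroup the diagonal $SU(2)$ and coset the three-sphere $S(3)$ of pseudo-translations. Let $P$ be a smooth principal $\mathbb G$-bundle over $M$, split with respect to the stability group: it has local trivializations over open sets $U_\alpha$ whose transition functions $t_{\alpha\beta}$ take values in the diagonal $SU(2)$. Let $H=A^kL_k+\theta^kQ_k$ be a connection on $P$ (local gauge fields on the $U_\alpha$)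 such that $\theta_x:T_xM\to\mathbb R^3$ is injective at every point, $K=dH+H\wedge H$ its field strength, and $\mathrm{Tr}(H\,dH+\tfrac23HHH)$ its Chern–Simons 3-form. Infinitesimal gauge transformations are $\delta_\varrho H=d\varrho+[H,\varrho]$. Let $m,\kappa,\mu\neq0$ be real, $\Lambda^2=\mu^2$ and $G=\kappa^2/(4m\mu)$. A *coframe bundle* $P'$ over $M$ is a principal $SO(3)$-bundle with an $\mathfrak{so}(3)$-connection $\omega^{ij}$ and a dreibein $e^i$ (local $\mathbb R^3$-valued 1-forms transforming in the vector representation, pointwise isomorphisms $T_xM\cong\mathbb R^3$), with curvature $\Omega^{ij}=d\omega^{ij}+\omega^i{}_k\omega^{kj}$ and torsion $T^i=de^i+\omega^i{}_je^j$. Put $$\mathrm{Diff}(D)^\Lambda_X=\{X\text{ smooth vector field on }M:\ \mathrm i_X(\Omega^{ij}-\Lambda^2e^ie^j)=0,\ \mathrm i_XT^i=0\}.$$ **Theorem.** There are a homomorphism $\Gamma_1:SU(2)\to SO(3)$, a linear isomorphism $\Gamma_2$ from the space of pseudo-translation parameters (smooth sections $\zeta=\zeta^kQ_k$ of the bundle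 associated with the adjoint action of the stability group on the span of the $Q_k$) onto the smooth vector fields on $M$, a diffeomorphism $\Gamma_3:M\to M'$, where $M'$ is the manifold $M$ with the metric $g=\delta_{ij}e^ie^j$, a coframe bundle $P'$ over $M'$ and a map $f:P\to P'$ such that: 1. ($\Gamma_1$) $\Gamma_1$ is surjective, $s\tau_js^{-1}=\sum_i\Gamma_1(s)_{ij}\tau_i$, and $P'$ has the cover $(U_\alpha)$ and the transition functions $\Gamma_1(t_{\alpha\beta})$. 2. ($\Gamma_3$) $\Gamma_3$ is the identity on points, and $g$ is well defined (independent of the trivialization) and positive definite. 3. ($f$) $f$ is continuous, covers $\Gamma_3$, satisfies $f(p\cdot(s,s))=f(p)\cdot\Gamma_1(s)$ for $s\in SU(2)$, and reads $(x,(a,b))\mapsto(x,\Gamma_1(b))$ in the trivializations; in particular $(x,(s,s))\mapsto(x,\Gamma_1(s))$ on the $SU(2)$-subbundle. 4. ($\Gamma_4$) $\omega_{jk}=-\epsilon_{jkl}A^l$ (that is, $A^i=-\tfrac12\epsilon^{ijk}\omega_{jk}$) and $\theta^i=\mu e^i$. Consequently, with $K=K_L^kL_k+K_Q^kQ_k$,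 one has $\Omega^{ij}-\Lambda^2e^ie^j=-\epsilon^{ijk}K_{L\,k}$ and $K_Q^i=\mu T^i$. 5. (Dynamics) On every $U_\alpha$, $$\frac{m}{4\pi\kappa^2}\mathrm{Tr}\Big(H\,dH+\frac23HHH\Big)=-\frac1{16\pi G}\,\epsilon_{ijk}e^i\Big(\Omega^{jk}-\frac{\Lambda^2}{3}e^je^k\Big)-\frac{m}{4\pi\kappa^2}\,d(A_k\wedge\theta^k),$$ so the Chern–Simons Lagrangian is, up to an exact form, the Einstein–Hilbert Lagrangian with cosmological constant; the 3-form $\epsilon_{ijk}e^i(\Omega^{jk}-\frac{\Lambda^2}{3}e^je^k)$ is globally defined on $M$. 6. (Local isometries) A gauge transformation with local parameter $\alpha^kL_k$ becomes $\delta\omega=d\alpha+[\omega,\alpha]$, $\delta e^i=-\alpha^i{}_je^j$ with $\alpha^{ij}=-\epsilon^{ijk}\alpha_k$. 7. ($\Gamma_2$) $\zeta^i=\mu\,\mathrm i_Xe^i$ for $X=\Gamma_2(\zeta)$. Moreover $X\in\mathrm{Diff}(D)^\Lambda_X$ if and only if the action $\delta_\zeta$ of the pseudo-translation on $(\omega,e)$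 is the Lie derivative along $X$ up to the local isometry with parameter $\mathrm i_X\omega$, i.e. $$(\mathcal L_X-\delta_\zeta)\omega=d(\mathrm i_X\omega)+[\omega,\mathrm i_X\omega],\qquad(\mathcal L_X-\delta_\zeta)e^i=-(\mathrm i_X\omega^i{}_k)e^k .$$ At every point the values of the elements of $\mathrm{Diff}(D)^\Lambda_X$ span a space of dimension at most $3$. -/

import Mathlib

open scoped Manifold ContDiff Matrix

noncomputable section

namespace GaugeGravity

/-! ### Differential forms of low degree on a three-dimensional manifold

A `q`-form with values in `F` assigns to every point `x` a function of `q` tangent vectors at `x`.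
Exterior and Lie derivatives at `x` are computed by the coordinate formulas in the preferred chart
`extChartAt x`; a vector of `TangentSpace x` is, by definition, its own list of components in that
chart. -/

abbrev E3 : Type := EuclideanSpace ℝ (Fin 3)

section Forms

variable {M : Type*} [TopologicalSpace M] [ChartedSpace E3 M]

/-- The tangent space of `M` at `x`. -/
abbrev Tan (x : M) : Type := TangentSpace 𝓘(ℝ, E3) x

/-- The vector with constant components `w` in the chart around `x₀`, at the point with
coordinates `y`. -/
def coordVec (x₀ : M) (w : E3) (y : E3) : Tan ((extChartAt 𝓘(ℝ, E3) x₀).symm y) :=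
  mfderiv 𝓘(ℝ, E3) 𝓘(ℝ, E3) (extChartAt 𝓘(ℝ, E3) x₀).symm y w

variable {F : Type*} [NormedAddCommGroup F] [NormedSpace ℝ F]

/-- The component along `v` of the 1-form `β`, as a function of the coordinates around `x₀`. -/
def coeff₁ (β : ∀ x : M, Tan x → F) (x₀ : M) (v : E3) : E3 → F :=
  fun y => β ((extChartAt 𝓘(ℝ, E3) x₀).symm y) (coordVec x₀ v y)

/-- The component along `v, w` of the 2-form `B`, as a function of the coordinates around `x₀`. -/
def coeff₂ (B : ∀ x : M, Tan x → Tan x → F) (x₀ : M) (v w : E3) : E3 → F :=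
  fun y => B ((extChartAt 𝓘(ℝ, E3) x₀).symm y) (coordVec x₀ v y) (coordVec x₀ w y)

/-- The components of the 1-form `β` in charts are smooth at every point of the open set `U`. -/
def SmoothOneFormOn (β : ∀ x : M, Tan x → F) (U : Set M) : Prop :=
  ∀ x ∈ U, ∀ v : E3, ContDiffAt ℝ ∞ (coeff₁ β x v) (extChartAt 𝓘(ℝ, E3) x x)

/-- Differential of a function: `(df)_x(v)`. -/
def d₀ (f : M → F) (x : M) (v : Tan x) : F :=
  mfderiv 𝓘(ℝ, E3) 𝓘(ℝ, F) f x v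

/-- Exterior derivative of a 1-form: `(dβ)_x(u,v) = ∂_u β_v - ∂_v β_u`. -/
def d₁ (β : ∀ x : M, Tan x → F) (x : M) (u v : Tan x) : F :=
  fderiv ℝ (coeff₁ β x v) (extChartAt 𝓘(ℝ, E3) x x) u
    - fderiv ℝ (coeff₁ β x u) (extChartAt 𝓘(ℝ, E3) x x) v

/-- Exterior derivative of a 2-form:
`(dB)_x(u,v,w) = ∂_u B_{vw} + ∂_v B_{wu} + ∂_w B_{uv}`. -/
def d₂ (B : ∀ x : M, Tan x → Tan x → F) (x : M) (u v w : Tan x) : F :=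
  fderiv ℝ (coeff₂ B x v w) (extChartAt 𝓘(ℝ, E3) x x) u
    + fderiv ℝ (coeff₂ B x w u) (extChartAt 𝓘(ℝ, E3) x x) v
    + fderiv ℝ (coeff₂ B x u v) (extChartAt 𝓘(ℝ, E3) x x) w

/-- The components of the vector field `X` as a function of the coordinates around `x₀`. -/
def coordField (X : ∀ x : M, Tan x) (x₀ : M) : E3 → E3 :=
  fun y => mfderiv 𝓘(ℝ, E3) 𝓘(ℝ, E3) (extChartAt 𝓘(ℝ, E3) x₀)
    ((extChartAt 𝓘(ℝ, E3) x₀).symm y) (X ((extChartAt 𝓘(ℝ, E3) x₀).symm y))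

/-- Lie derivative of a 1-form: `(L_X β)_μ = X^ν ∂_ν β_μ + β_ν ∂_μ X^ν`. -/
def lieDeriv (X : ∀ x : M, Tan x) (β : ∀ x : M, Tan x → F) (x : M) (v : Tan x) : F :=
  fderiv ℝ (coeff₁ β x v) (extChartAt 𝓘(ℝ, E3) x x) (X x)
    + β x (fderiv ℝ (coordField X x) (extChartAt 𝓘(ℝ, E3) x x) v)

section MatrixForms

variable {n : Type*} {𝕂 : Type*} [NormedField 𝕂] [NormedAlgebra ℝ 𝕂]

/-- `d₀`, `d₁` and `lieDeriv` of matrix-valued forms are taken entry by entry. -/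
def d₀Mat (f : M → Matrix n n 𝕂) (x : M) (v : Tan x) : Matrix n n 𝕂 :=
  Matrix.of fun a b => d₀ (fun y => f y a b) x v

def d₁Mat (β : ∀ x : M, Tan x → Matrix n n 𝕂) (x : M) (u v : Tan x) : Matrix n n 𝕂 :=
  Matrix.of fun a b => d₁ (fun y w => β y w a b) x u v

def lieDerivMat (X : ∀ x : M, Tan x) (β : ∀ x : M, Tan x → Matrix n n 𝕂)
    (x : M) (v : Tan x) : Matrix n n 𝕂 :=
  Matrix.of fun a b => lieDeriv X (fun y w => β y w a b) x v

/-- Curvature 2-form `dβ + β ∧ β` of a matrix-valued 1-form. -/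
def curvature [Fintype n] (β : ∀ x : M, Tan x → Matrix n n 𝕂) (x : M) (u v : Tan x) :
    Matrix n n 𝕂 :=
  d₁Mat β x u v + (β x u * β x v - β x v * β x u)

/-- Infinitesimal gauge variation `dρ + [β, ρ]` of a matrix-valued connection 1-form `β`. -/
def gaugeVar [Fintype n] (β : ∀ x : M, Tan x → Matrix n n 𝕂) (ρ : M → Matrix n n 𝕂)
    (x : M) (v : Tan x) : Matrix n n 𝕂 :=
  d₀Mat ρ x v + (β x v * ρ x - ρ x * β x v)

end MatrixForms

end Forms

/-! ### Principal bundles and connections -/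

section Bundles

variable {G : Type*} [Group G] [TopologicalSpace G]
  {n : Type*} [Fintype n] [DecidableEq n] {𝕂 : Type*} [NormedField 𝕂] [NormedAlgebra ℝ 𝕂]

/-- A smooth principal `G`-bundle over `M`, for a matrix group `r : G →* Matrix n n 𝕂`, given by
an open cover and the transition functions `t i j = φᵢ⁻¹ ∘ φⱼ`, so that
`φⱼ(x, g) = φᵢ(x, t i j x * g)`. Its total space is `P.core.TotalSpace` below. -/
structure PrincipalBundle (r : G →* Matrix n n 𝕂) (M : Type*) [TopologicalSpace M]
    [ChartedSpace E3 M] (ι : Type*) where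
  U : ι → Set M
  isOpen_U : ∀ i, IsOpen (U i)
  indexAt : M → ι
  mem_indexAt : ∀ x, x ∈ U (indexAt x)
  t : ι → ι → M → G
  t_self : ∀ i, ∀ x ∈ U i, t i i x = 1
  t_mul : ∀ i j k, ∀ x ∈ U i ∩ U j ∩ U k, t i j x * t j k x = t i k x
  continuousOn_t : ∀ i j, ContinuousOn (t i j) (U i ∩ U j)
  smooth_t : ∀ i j a b,
    ContMDiffOn 𝓘(ℝ, E3) 𝓘(ℝ, 𝕂) ∞ (fun x => r (t i j x) a b) (U i ∩ U j)

variable {r : G →* Matrix n n 𝕂} {M : Type*} [TopologicalSpace M] [ChartedSpace E3 M] {ι : Type*}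

/-- The fibre bundle with fibre `G` on which the transition functions act by left translation. -/
def PrincipalBundle.core [ContinuousMul G] (P : PrincipalBundle r M ι) :
    FiberBundleCore ι M G where
  baseSet := P.U
  isOpen_baseSet := P.isOpen_U
  indexAt := P.indexAt
  mem_baseSet_at := P.mem_indexAt
  coordChange i j x g := P.t j i x * g
  coordChange_self i x hx g := by rw [P.t_self i x hx, one_mul]
  continuousOn_coordChange i j := by
    refine ContinuousOn.mul ?_ continuous_snd.continuousOn
    exact (P.continuousOn_t j i).comp continuous_fst.continuousOn
      (fun p hp => ⟨hp.1.2, hp.1.1⟩)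
  coordChange_comp i j k x hx g := by
    rw [← mul_assoc, P.t_mul k j i x ⟨⟨hx.2, hx.1.2⟩, hx.1.1⟩]

/-- The total space `P`. -/
abbrev PrincipalBundle.Total [ContinuousMul G] (P : PrincipalBundle r M ι) : Type _ :=
  P.core.TotalSpace

/-- The right action of `G` on the total space. -/
def PrincipalBundle.act [ContinuousMul G] (P : PrincipalBundle r M ι) (p : P.Total) (g : G) :
    P.Total :=
  ⟨p.1, (show G from p.2) * g⟩

/-- The group coordinate of `p` in the `i`-th trivialization: `p = φᵢ(π p, coord i p)`
whenever `π p ∈ U i`. -/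
def PrincipalBundle.coord [ContinuousMul G] (P : PrincipalBundle r M ι) (i : ι) (p : P.Total) :
    G :=
  (P.core.localTriv i p).2

/-- A connection on `P` with values in the Lie algebra `𝔤`: the local gauge fields, obeying
`βⱼ = g⁻¹ βᵢ g + g⁻¹ dg`, `g = t i j`, on overlaps. -/
structure Connection (P : PrincipalBundle r M ι) (𝔤 : Submodule ℝ (Matrix n n 𝕂)) where
  form : ι → ∀ x : M, Tan x →ₗ[ℝ] Matrix n n 𝕂
  mem : ∀ i, ∀ x ∈ P.U i, ∀ v, form i x v ∈ 𝔤
  smooth : ∀ i a b, SmoothOneFormOn (fun x v => form i x v a b) (P.U i)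
  glue : ∀ i j, ∀ x ∈ P.U i ∩ P.U j, ∀ v,
    form j x v = r (P.t i j x)⁻¹ * form i x v * r (P.t i j x)
      + r (P.t i j x)⁻¹ * d₀Mat (fun y => r (P.t i j y)) x v

end Bundles

/-! ### The gauge group and its Lie algebra

`so(4) = su(2) ⊕ su(2)` with generators `L k = (τₖ, τₖ)`, `Q k = (τₖ, -τₖ)`, `τₖ = -(i/2) σₖ`, so
that `[L,L] = ε L`, `[L,Q] = ε Q`, `[Q,Q] = ε L`, and `Tr(LL) = Tr(QQ) = 0`, `Tr(LQ) = η`.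
The group with this Lie algebra that has `SU(2)` (the diagonal) as stability subgroup and the
three-sphere as coset is `SU(2) × SU(2)`. -/

abbrev SU2 : Type := Matrix.specialUnitaryGroup (Fin 2) ℂ

abbrev SO3 : Type := Matrix.specialOrthogonalGroup (Fin 3) ℝ

/-- The gauge group, as block diagonal matrices. -/
def gaugeRep : SU2 × SU2 →* Matrix (Fin 2 ⊕ Fin 2) (Fin 2 ⊕ Fin 2) ℂ where
  toFun s := Matrix.fromBlocks (s.1 : Matrix (Fin 2) (Fin 2) ℂ) 0 0
    (s.2 : Matrix (Fin 2) (Fin 2) ℂ)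
  map_one' := by simp [Matrix.fromBlocks_one]
  map_mul' s t := by simp [Matrix.fromBlocks_multiply]

/-- The defining representation of `SO(3)`. -/
def so3Rep : SO3 →* Matrix (Fin 3) (Fin 3) ℝ :=
  (Matrix.specialOrthogonalGroup (Fin 3) ℝ).subtype

/-- The Lie algebra of `SO(3)`: antisymmetric matrices. -/
def so3 : Submodule ℝ (Matrix (Fin 3) (Fin 3) ℝ) where
  carrier := {A | Aᵀ = -A}
  add_mem' := by
    intro A B (hA : Aᵀ = -A) (hB : Bᵀ = -B)
    change (A + B)ᵀ = -(A + B)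
    rw [Matrix.transpose_add, hA, hB, neg_add]
  zero_mem' := by simp
  smul_mem' := by
    intro c A (hA : Aᵀ = -A)
    change (c • A)ᵀ = -(c • A)
    rw [Matrix.transpose_smul, hA, smul_neg]

/-- The Levi-Civita symbol `ε_{ijk}`, with `ε_{012} = 1`. -/
def eps (i j k : Fin 3) : ℝ :=
  ((j : ℝ) - (i : ℝ)) * ((k : ℝ) - (j : ℝ)) * ((k : ℝ) - (i : ℝ)) / 2

/-- The generators `τₖ = -(i/2) σₖ` of `su(2)`. -/
def tau : Fin 3 → Matrix (Fin 2) (Fin 2) ℂ :=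
  ![!![0, -(Complex.I / 2); -(Complex.I / 2), 0],
    !![0, -(1 / 2); 1 / 2, 0],
    !![-(Complex.I / 2), 0; 0, Complex.I / 2]]

/-- The generators of the stability group. -/
def genL (k : Fin 3) : Matrix (Fin 2 ⊕ Fin 2) (Fin 2 ⊕ Fin 2) ℂ :=
  Matrix.fromBlocks (tau k) 0 0 (tau k)

/-- The generators of the pseudo-translations. -/
def genQ (k : Fin 3) : Matrix (Fin 2 ⊕ Fin 2) (Fin 2 ⊕ Fin 2) ℂ :=
  Matrix.fromBlocks (tau k) 0 0 (-tau k)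

/-- The Lie algebra of the gauge group. -/
def so4 : Submodule ℝ (Matrix (Fin 2 ⊕ Fin 2) (Fin 2 ⊕ Fin 2) ℂ) :=
  Submodule.span ℝ (Set.range genL ∪ Set.range genQ)

/-- The invariant quadratic form, `Tr(Z W) = invTr (Z * W)`. -/
def invTr (Z : Matrix (Fin 2 ⊕ Fin 2) (Fin 2 ⊕ Fin 2) ℂ) : ℝ :=
  (Z.toBlocks₂₂.trace - Z.toBlocks₁₁.trace).re

/-- For `Z = aᵏ L k + bᵏ Q k`, the coefficients `a`. -/
def compL (Z : Matrix (Fin 2 ⊕ Fin 2) (Fin 2 ⊕ Fin 2) ℂ) : Fin 3 → ℝ :=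
  fun k => invTr (Z * genQ k)

/-- For `Z = aᵏ L k + bᵏ Q k`, the coefficients `b`. -/
def compQ (Z : Matrix (Fin 2 ⊕ Fin 2) (Fin 2 ⊕ Fin 2) ℂ) : Fin 3 → ℝ :=
  fun k => invTr (Z * genL k)

/-- The matrix `ζᵏ Q k`. -/
def toQ (ζ : Fin 3 → ℝ) : Matrix (Fin 2 ⊕ Fin 2) (Fin 2 ⊕ Fin 2) ℂ :=
  ∑ k, ζ k • genQ k

/-- The matrix `αᵏ L k`. -/
def toL (α : Fin 3 → ℝ) : Matrix (Fin 2 ⊕ Fin 2) (Fin 2 ⊕ Fin 2) ℂ :=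
  ∑ k, α k • genL k

/-- `a ↦ ω`, `ω^{jk} = -ε^{jkl} a_l`, equivalently `a^i = -½ ε^{ijk} ω_{jk}`. -/
def toSpin (a : Fin 3 → ℝ) : Matrix (Fin 3) (Fin 3) ℝ :=
  Matrix.of fun j k => -∑ l, eps j k l * a l

/-! ### The gauge theory -/

section Gauge

variable {M : Type*} [TopologicalSpace M] [ChartedSpace E3 M] {ι : Type*}

/-- A principal bundle with the gauge group as structure group. -/
abbrev GaugeBundle (M : Type*) [TopologicalSpace M] [ChartedSpace E3 M] (ι : Type*) :=
  PrincipalBundle gaugeRep M ι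

/-- The bundle is split with respect to the stability group: the trivializations are adapted to a
reduction to the diagonal `SU(2)`, i.e. the transition functions take values in it. -/
def IsSplit (P : GaugeBundle M ι) : Prop :=
  ∀ i j, ∀ x ∈ P.U i ∩ P.U j, (P.t i j x).1 = (P.t i j x).2

/-- The gauge field `H = Aᵏ L k + θᵏ Q k`. -/
abbrev GaugeField (P : GaugeBundle M ι) := Connection P so4

variable {P : GaugeBundle M ι}

/-- The component `A` of the gauge field. -/
def GaugeField.A (H : GaugeField P) (i : ι) (x : M) (v : Tan x) : Fin 3 → ℝ :=
  compL (H.form i x v)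

/-- The component `θ` of the gauge field. -/
def GaugeField.θ (H : GaugeField P) (i : ι) (x : M) (v : Tan x) : Fin 3 → ℝ :=
  compQ (H.form i x v)

/-- The field strength `K = dH + HH` in the `i`-th trivialization. -/
def GaugeField.K (H : GaugeField P) (i : ι) (x : M) (u v : Tan x) :
    Matrix (Fin 2 ⊕ Fin 2) (Fin 2 ⊕ Fin 2) ℂ :=
  curvature (fun y w => H.form i y w) x u v

/-- The 3-form `Tr (H dH + (2/3) H H H)` in the `i`-th trivialization. -/
def GaugeField.chernSimons (H : GaugeField P) (i : ι) (x : M) (u v w : Tan x) : ℝ :=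
  let h := H.form i x
  let dh := d₁Mat (fun y z => H.form i y z) x
  invTr ((h u * dh v w + h v * dh w u + h w * dh u v)
    + (2 / 3 : ℝ) • (h u * (h v * h w - h w * h v) + h v * (h w * h u - h u * h w)
      + h w * (h u * h v - h v * h u)))

/-- The 2-form `A_k ∧ θ^k` in the `i`-th trivialization. -/
def GaugeField.Aθ (H : GaugeField P) (i : ι) (x : M) (u v : Tan x) : ℝ :=
  H.A i x u ⬝ᵥ H.θ i x v - H.A i x v ⬝ᵥ H.θ i x u

/-- The parameters of the infinitesimal pseudo-translations: sections `ζ = ζᵏ Q k` of the bundle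
associated with the adjoint action of the stability group on the span of the `Q k`, given by their
components `ζ i` in the trivializations (extended by zero outside of `U i`). -/
def pseudoTranslations (P : GaugeBundle M ι) : Submodule ℝ (ι → M → Fin 3 → ℝ) where
  carrier := {ζ | (∀ i, ∀ x ∉ P.U i, ζ i x = 0) ∧
    (∀ i, ContMDiffOn 𝓘(ℝ, E3) 𝓘(ℝ, Fin 3 → ℝ) ∞ (ζ i) (P.U i)) ∧
    ∀ i j, ∀ x ∈ P.U i ∩ P.U j,
      toQ (ζ j x) = gaugeRep (P.t i j x)⁻¹ * toQ (ζ i x) * gaugeRep (P.t i j x)}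
  add_mem' := by
    have h : ∀ a b, toQ (a + b) = toQ a + toQ b := fun a b => by
      simp [toQ, add_smul, Finset.sum_add_distrib]
    rintro a b ⟨ha, ha', ha''⟩ ⟨hb, hb', hb''⟩
    refine ⟨fun i x hx => ?_, fun i => (ha' i).add (hb' i), fun i j x hx => ?_⟩
    · simp [ha i x hx, hb i x hx]
    · simp only [Pi.add_apply, h, ha'' i j x hx, hb'' i j x hx, mul_add, add_mul]
  zero_mem' := by
    refine ⟨fun _ _ _ => rfl, fun _ => contMDiffOn_const, fun i j x _ => ?_⟩
    simp [toQ]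
  smul_mem' := by
    have h : ∀ (c : ℝ) a, toQ (c • a) = c • toQ a := fun c a => by
      simp [toQ, mul_smul, Finset.smul_sum]
    rintro c a ⟨ha, ha', ha''⟩
    refine ⟨fun i x hx => ?_, fun i => (contDiff_const_smul c).contMDiff.comp_contMDiffOn (ha' i),
      fun i j x hx => ?_⟩
    · simp [ha i x hx]
    · simp only [Pi.smul_apply, h, ha'' i j x hx, mul_smul_comm, smul_mul_assoc]

end Gauge

/-! ### The gravity theory -/

section Gravity

/-- The coframe bundle of a three-dimensional Riemann-Cartan manifold: a principal `SO(3)`-bundle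
with a spin connection `ω = spin` and a dreibein (soldering form) `e`, which is pointwise an isomorphism
of the tangent space with `ℝ³`. -/
structure CoframeBundle (M : Type*) [TopologicalSpace M] [ChartedSpace E3 M] (ι : Type*) extends
    PrincipalBundle so3Rep M ι where
  spin : Connection toPrincipalBundle so3
  e : ι → ∀ x : M, Tan x →ₗ[ℝ] (Fin 3 → ℝ)
  smooth_e : ∀ i, SmoothOneFormOn (fun x v => e i x v) (U i)
  bijective_e : ∀ i, ∀ x ∈ U i, Function.Bijective (e i x)
  glue_e : ∀ i j, ∀ x ∈ U i ∩ U j, ∀ v, e j x v = so3Rep (t i j x)⁻¹ *ᵥ e i x v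

variable {M : Type*} [TopologicalSpace M] [ChartedSpace E3 M] {ι : Type*}

/-- The curvature 2-form `Ω = dω + ωω`. -/
def CoframeBundle.Ω (C : CoframeBundle M ι) (i : ι) (x : M) (u v : Tan x) :
    Matrix (Fin 3) (Fin 3) ℝ :=
  curvature (fun y w => C.spin.form i y w) x u v

/-- The torsion 2-form `T = de + ω e`. -/
def CoframeBundle.T (C : CoframeBundle M ι) (i : ι) (x : M) (u v : Tan x) : Fin 3 → ℝ :=
  d₁ (fun y w => C.e i y w) x u v + (C.spin.form i x u *ᵥ C.e i x v - C.spin.form i x v *ᵥ C.e i x u)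

/-- The 2-form `e^j ∧ e^k`. -/
def CoframeBundle.ee (C : CoframeBundle M ι) (i : ι) (x : M) (u v : Tan x) :
    Matrix (Fin 3) (Fin 3) ℝ :=
  Matrix.of fun j k => C.e i x u j * C.e i x v k - C.e i x v j * C.e i x u k

/-- The 3-form `ε_{ljk} e^l ∧ (Ω^{jk} - (Λ²/3) e^j ∧ e^k)`. -/
def CoframeBundle.einsteinHilbert (C : CoframeBundle M ι) (Λ : ℝ) (i : ι) (x : M)
    (u v w : Tan x) : ℝ :=
  let B := fun a b : Tan x => C.Ω i x a b - (Λ ^ 2 / 3) • C.ee i x a b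
  ∑ l, ∑ j, ∑ k, eps l j k *
    (C.e i x u l * B v w j k + C.e i x v l * B w u j k + C.e i x w l * B u v j k)

/-- The metric of the Riemann-Cartan manifold, `g = η_{kl} e^k e^l`, computed in a trivialization
around `x`. -/
def CoframeBundle.metric (C : CoframeBundle M ι) (x : M) (u v : Tan x) : ℝ :=
  C.e (C.indexAt x) x u ⬝ᵥ C.e (C.indexAt x) x v

/-- Smooth vector fields, the infinitesimal diffeomorphisms. -/
abbrev SmoothVectorField (M : Type*) [TopologicalSpace M] [ChartedSpace E3 M]
    [IsManifold 𝓘(ℝ, E3) ∞ M] : Type _ :=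
  ContMDiffSection 𝓘(ℝ, E3) E3 ∞ (fun x : M => TangentSpace 𝓘(ℝ, E3) x)

/-- The restricted diffeomorphisms: `i_X (Ω - Λ² e e) = 0` and `i_X T = 0`. -/
def CoframeBundle.restrictedDiff [IsManifold 𝓘(ℝ, E3) ∞ M] (C : CoframeBundle M ι) (Λ : ℝ) :
    Set (SmoothVectorField M) :=
  {X | ∀ i, ∀ x ∈ C.U i, ∀ v : Tan x,
    C.Ω i x (X x) v - Λ ^ 2 • C.ee i x (X x) v = 0 ∧ C.T i x (X x) v = 0}

end Gravity

end GaugeGravity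

end

/-!
The first-order form of three-dimensional gravity is a rewriting of the gauge theory. In the split
`H = Aᵏ Lₖ + θᵏ Qₖ`, the transition functions take values in the diagonal `SU(2)`, so the gluing
condition for `H` says that `A` is an `SU(2)`-connection and that `θ` transforms as a vector
(`GaugeField.glue_components`). The adjoint representation `SU(2) → SO(3)` (`su2ToSO3`) turns `A`
into an `SO(3)`-connection `ω = toSpin A`, because the differential of the adjoint representation
is `toSpin` (`adForm_add_adForm`), and turns `e = θ / μ` into a dreibein; this is the coframe bundle
`coframe`. Surjectivity of `su2ToSO3` is the Euler angle decomposition of rotations.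

All brackets are cross products of coefficient vectors: `[L, L] = L`, `[L, Q] = Q`, `[Q, Q] = L`
(`commutator_toL_add_toQ`), and `toSpin` is an isomorphism of Lie algebras that sends `a × b` to
`-(a ∧ b)`. Hence the `L`-part of the field strength is `dA + A × A + θ × θ`, which `toSpin`
maps to `Ω - μ² e ∧ e`, and its `Q`-part is `dθ + A × θ`, which is `μ T`. The same
bookkeeping in the Chern–Simons form, which pairs `L` with `Q`, leaves
`2 θ · (dA + A × A + θ × θ / 3)` after the term `d (A · θ)` has been split off
(`chernSimons_eq_einsteinHilbert`). The Einstein–Hilbert form is globally defined because the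
curvature is conjugated by the transition functions (`Connection.curvature_glue`, which uses the
symmetry of second derivatives) and the Levi-Civita symbol is invariant under rotations.

Pseudo-translation parameters are the contractions `ζ = θ(X)` with vector fields, bijectively, since
`θ` is a pointwise isomorphism and inversion of linear maps is smooth
(`bijective_pseudoOfVectorField`). Cartan's formula `L_X β = i_X dβ + d (i_X β)` (`lieDeriv_eq`)
shows that `L_X - δ_ζ` differs from the local isometry with parameter `i_X ω` by exactly
`i_X (Ω - Λ² e ∧ e)` on `ω` and by `i_X T` on `e`, which vanish precisely for the restricted
diffeomorphisms.
-/

noncomputable section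

namespace GaugeGravity

/-! ### The Lie algebras `su(2)`, `so(3)` and `so(4)` -/

/-- The element `aᵏ τₖ` of `su(2)`. -/
def toTau (a : Fin 3 → ℝ) : Matrix (Fin 2) (Fin 2) ℂ :=
  ∑ k, a k • tau k

/-- The coefficients of an element of `su(2)` in the basis `τₖ`, read off from
`tr (τⱼ τₖ) = -δⱼₖ / 2`; as a real linear map on all complex matrices. -/
def tauCoeff : Matrix (Fin 2) (Fin 2) ℂ →ₗ[ℝ] Fin 3 → ℝ where
  toFun Z := fun k => -2 * (Z * tau k).trace.re
  map_add' Z W := by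
    ext k
    simp [add_mul, mul_add]
  map_smul' c Z := by
    ext k
    simp [mul_left_comm]

theorem toTau_eq (a : Fin 3 → ℝ) :
    toTau a = !![-(Complex.I / 2) * a 2, -(Complex.I / 2) * a 0 - a 1 / 2;
      -(Complex.I / 2) * a 0 + a 1 / 2, Complex.I / 2 * a 2] := by
  ext i j
  fin_cases i <;> fin_cases j <;>
    simp [toTau, tau, Fin.sum_univ_three, Complex.ext_iff] <;> ring_nf <;> simp

theorem toTau_add (a b : Fin 3 → ℝ) : toTau (a + b) = toTau a + toTau b := by
  simp [toTau, add_smul, Finset.sum_add_distrib]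

theorem toTau_sub (a b : Fin 3 → ℝ) : toTau (a - b) = toTau a - toTau b := by
  simp [toTau, sub_smul, Finset.sum_sub_distrib]

theorem tauCoeff_toTau (a : Fin 3 → ℝ) : tauCoeff (toTau a) = a := by
  ext k
  rw [toTau_eq]
  fin_cases k <;>
    simp [tauCoeff, tau, Matrix.trace_fin_two, Matrix.mul_apply, Fin.sum_univ_two] <;> ring

theorem toTau_injective : Function.Injective toTau :=
  Function.LeftInverse.injective tauCoeff_toTau

theorem toTau_commutator (a b : Fin 3 → ℝ) :
    toTau a * toTau b - toTau b * toTau a = toTau (a ⨯₃ b) := by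
  simp only [toTau_eq, cross_apply]
  ext i j
  fin_cases i <;> fin_cases j <;> simp [Complex.ext_iff] <;> constructor <;> ring

theorem star_toTau (a : Fin 3 → ℝ) : star (toTau a) = -toTau a := by
  rw [toTau_eq]
  ext i j
  fin_cases i <;> fin_cases j <;> simp [Complex.ext_iff] <;> ring

theorem toL_eq (a : Fin 3 → ℝ) : toL a = Matrix.fromBlocks (toTau a) 0 0 (toTau a) := by
  simp only [toL, toTau, Fin.sum_univ_three, genL, Matrix.fromBlocks_smul, Matrix.fromBlocks_add,
    smul_zero, add_zero]

theorem toQ_eq (a : Fin 3 → ℝ) : toQ a = Matrix.fromBlocks (toTau a) 0 0 (-toTau a) := by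
  simp only [toQ, toTau, Fin.sum_univ_three, genQ, Matrix.fromBlocks_smul, Matrix.fromBlocks_add,
    smul_zero, add_zero, smul_neg, neg_add]

theorem toL_add_toQ (a b : Fin 3 → ℝ) :
    toL a + toQ b = Matrix.fromBlocks (toTau (a + b)) 0 0 (toTau (a - b)) := by
  rw [toL_eq, toQ_eq, Matrix.fromBlocks_add, toTau_add, toTau_sub, sub_eq_add_neg, add_zero]

theorem tauCoeff_apply (Z : Matrix (Fin 2) (Fin 2) ℂ) (k : Fin 3) :
    tauCoeff Z k = -2 * (Z * tau k).trace.re := rfl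

theorem compL_fromBlocks (X Y Z W : Matrix (Fin 2) (Fin 2) ℂ) :
    compL (Matrix.fromBlocks X Y Z W) = (1 / 2 : ℝ) • (tauCoeff X + tauCoeff W) := by
  ext k
  simp [compL, invTr, genQ, Matrix.fromBlocks_multiply, tauCoeff_apply]
  ring

theorem compQ_fromBlocks (X Y Z W : Matrix (Fin 2) (Fin 2) ℂ) :
    compQ (Matrix.fromBlocks X Y Z W) = (1 / 2 : ℝ) • (tauCoeff X - tauCoeff W) := by
  ext k
  simp [compQ, invTr, genL, Matrix.fromBlocks_multiply, tauCoeff_apply]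
  ring

theorem compL_toL_add_toQ (a b : Fin 3 → ℝ) : compL (toL a + toQ b) = a := by
  rw [toL_add_toQ, compL_fromBlocks, tauCoeff_toTau, tauCoeff_toTau]
  ext k
  simp
  ring

theorem compQ_toL_add_toQ (a b : Fin 3 → ℝ) : compQ (toL a + toQ b) = b := by
  rw [toL_add_toQ, compQ_fromBlocks, tauCoeff_toTau, tauCoeff_toTau]
  ext k
  simp
  ring

/-- `compL` as a real linear map. -/
def compLLinear : Matrix (Fin 2 ⊕ Fin 2) (Fin 2 ⊕ Fin 2) ℂ →ₗ[ℝ] Fin 3 → ℝ where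
  toFun := compL
  map_add' Z W := by
    rw [← Z.fromBlocks_toBlocks, ← W.fromBlocks_toBlocks, Matrix.fromBlocks_add]
    simp only [compL_fromBlocks, map_add]
    module
  map_smul' c Z := by
    rw [← Z.fromBlocks_toBlocks, Matrix.fromBlocks_smul]
    simp only [compL_fromBlocks, map_smul, RingHom.id_apply]
    module

/-- `compQ` as a real linear map. -/
def compQLinear : Matrix (Fin 2 ⊕ Fin 2) (Fin 2 ⊕ Fin 2) ℂ →ₗ[ℝ] Fin 3 → ℝ where
  toFun := compQ
  map_add' Z W := by
    rw [← Z.fromBlocks_toBlocks, ← W.fromBlocks_toBlocks, Matrix.fromBlocks_add]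
    simp only [compQ_fromBlocks, map_add]
    module
  map_smul' c Z := by
    rw [← Z.fromBlocks_toBlocks, Matrix.fromBlocks_smul]
    simp only [compQ_fromBlocks, map_smul, RingHom.id_apply]
    module

/-- `toQ` as a real linear map. -/
def toQLinear : (Fin 3 → ℝ) →ₗ[ℝ] Matrix (Fin 2 ⊕ Fin 2) (Fin 2 ⊕ Fin 2) ℂ where
  toFun := toQ
  map_add' a b := by simp [toQ, add_smul, Finset.sum_add_distrib]
  map_smul' c a := by simp [toQ, mul_smul, Finset.smul_sum]

/-- `toL` as a real linear map. -/
def toLLinear : (Fin 3 → ℝ) →ₗ[ℝ] Matrix (Fin 2 ⊕ Fin 2) (Fin 2 ⊕ Fin 2) ℂ where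
  toFun := toL
  map_add' a b := by simp [toL, add_smul, Finset.sum_add_distrib]
  map_smul' c a := by simp [toL, mul_smul, Finset.smul_sum]

/-- `toSpin` as a real linear map. -/
def toSpinLinear : (Fin 3 → ℝ) →ₗ[ℝ] Matrix (Fin 3) (Fin 3) ℝ where
  toFun := toSpin
  map_add' a b := by
    ext j k
    simp [toSpin, mul_add, Finset.sum_add_distrib, add_comm]
  map_smul' c a := by
    ext j k
    simp [toSpin, Finset.mul_sum, mul_left_comm]

/-- `L₀, …, Q₂` span the Lie algebra, and `compL`, `compQ` are the coordinates. -/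
theorem eq_toL_add_toQ {Z : Matrix (Fin 2 ⊕ Fin 2) (Fin 2 ⊕ Fin 2) ℂ} (hZ : Z ∈ so4) :
    Z = toL (compL Z) + toQ (compQ Z) := by
  have hL : ∀ k, genL k = toL (Pi.single k 1) + toQ 0 := fun k => by
    simp [toL, toQ, Pi.single_apply, ite_smul]
  have hQ : ∀ k, genQ k = toL 0 + toQ (Pi.single k 1) := fun k => by
    simp [toL, toQ, Pi.single_apply, ite_smul]
  have key : so4 ≤ LinearMap.eqLocus LinearMap.id
      (toLLinear ∘ₗ compLLinear + toQLinear ∘ₗ compQLinear) := by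
    refine Submodule.span_le.2 ?_
    rintro _ (⟨k, rfl⟩ | ⟨k, rfl⟩)
    · change genL k = toL (compL (genL k)) + toQ (compQ (genL k))
      rw [hL, compL_toL_add_toQ, compQ_toL_add_toQ]
    · change genQ k = toL (compL (genQ k)) + toQ (compQ (genQ k))
      rw [hQ, compL_toL_add_toQ, compQ_toL_add_toQ]
  exact key hZ

/-- The brackets `[L, L] = ε L`, `[L, Q] = ε Q`, `[Q, Q] = ε L`. -/
theorem commutator_toL_add_toQ (a b a' b' : Fin 3 → ℝ) :
    (toL a + toQ b) * (toL a' + toQ b') - (toL a' + toQ b') * (toL a + toQ b)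
      = toL (a ⨯₃ a' + b ⨯₃ b') + toQ (a ⨯₃ b' + b ⨯₃ a') := by
  simp only [toL_add_toQ, Matrix.fromBlocks_multiply, sub_eq_add_neg, Matrix.fromBlocks_neg,
    Matrix.fromBlocks_add]
  simp only [mul_zero, zero_mul, add_zero, zero_add, neg_zero]
  congr 1
  · rw [← sub_eq_add_neg, toTau_commutator]
    congr 1
    simp only [map_add, LinearMap.add_apply]
    abel
  · rw [← sub_eq_add_neg, toTau_commutator]
    congr 1
    simp only [map_add, map_neg, LinearMap.add_apply, LinearMap.neg_apply]
    abel

/-- The invariant form pairs `L` with `Q`. -/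
theorem invTr_mul (a b a' b' : Fin 3 → ℝ) :
    invTr ((toL a + toQ b) * (toL a' + toQ b')) = a ⬝ᵥ b' + b ⬝ᵥ a' := by
  simp only [toL_add_toQ, Matrix.fromBlocks_multiply, invTr, toTau_eq]
  simp [Matrix.trace_fin_two, dotProduct, Fin.sum_univ_three]
  ring

theorem invTr_add (Z W : Matrix (Fin 2 ⊕ Fin 2) (Fin 2 ⊕ Fin 2) ℂ) :
    invTr (Z + W) = invTr Z + invTr W := by
  rw [← Z.fromBlocks_toBlocks, ← W.fromBlocks_toBlocks, Matrix.fromBlocks_add]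
  simp [invTr]
  ring

theorem invTr_smul (c : ℝ) (Z : Matrix (Fin 2 ⊕ Fin 2) (Fin 2 ⊕ Fin 2) ℂ) :
    invTr (c • Z) = c * invTr Z := by
  rw [← Z.fromBlocks_toBlocks, Matrix.fromBlocks_smul]
  simp [invTr]
  ring

theorem toSpin_eq (a : Fin 3 → ℝ) :
    toSpin a = !![0, -a 2, a 1; a 2, 0, -a 0; -a 1, a 0, 0] := by
  ext j k
  fin_cases j <;> fin_cases k <;> simp [toSpin, eps, Fin.sum_univ_three] <;> norm_num

theorem toSpin_mem (a : Fin 3 → ℝ) : toSpin a ∈ so3 := by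
  change (toSpin a)ᵀ = -toSpin a
  rw [toSpin_eq]
  ext j k
  fin_cases j <;> fin_cases k <;> simp

theorem toSpin_mulVec (a b : Fin 3 → ℝ) : toSpin a *ᵥ b = a ⨯₃ b := by
  rw [toSpin_eq, cross_apply]
  ext j
  fin_cases j <;> simp [Matrix.mulVec, dotProduct, Fin.sum_univ_three] <;> ring

theorem toSpin_commutator (a b : Fin 3 → ℝ) :
    toSpin a * toSpin b - toSpin b * toSpin a = toSpin (a ⨯₃ b) := by
  simp only [toSpin_eq, cross_apply]
  ext i j
  fin_cases i <;> fin_cases j <;> simp <;> ring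

theorem toSpin_cross (a b : Fin 3 → ℝ) :
    toSpin (a ⨯₃ b) = -Matrix.of fun j k => a j * b k - b j * a k := by
  simp only [toSpin_eq, cross_apply]
  ext i j
  fin_cases i <;> fin_cases j <;> simp <;> ring

theorem sum_eps_mul (a : Fin 3 → ℝ) (B : Matrix (Fin 3) (Fin 3) ℝ) :
    ∑ l, ∑ j, ∑ k, eps l j k * (a l * B j k)
      = a ⬝ᵥ ![B 1 2 - B 2 1, B 2 0 - B 0 2, B 0 1 - B 1 0] := by
  simp [eps, Fin.sum_univ_three, dotProduct]
  ring

/-- The contraction of a vector and a matrix with `ε` is invariant under rotations: the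
Levi-Civita symbol transforms with the determinant. -/
theorem sum_eps_mul_conj (O : Matrix (Fin 3) (Fin 3) ℝ) (hdet : O.det = 1)
    (a : Fin 3 → ℝ) (B : Matrix (Fin 3) (Fin 3) ℝ) :
    ∑ l, ∑ j, ∑ k, eps l j k * ((O *ᵥ a) l * (O * B * Oᵀ) j k)
      = ∑ l, ∑ j, ∑ k, eps l j k * (a l * B j k) := by
  rw [← one_mul (∑ l, ∑ j, ∑ k, eps l j k * (a l * B j k)), ← hdet, sum_eps_mul, sum_eps_mul]
  simp only [Matrix.det_fin_three, dotProduct, Matrix.mulVec, Matrix.mul_apply,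
    Matrix.transpose_apply, Fin.sum_univ_three, Matrix.cons_val]
  ring

/-! ### The double cover `SU(2) → SO(3)` -/

/-- The polarization of the adjoint action: the matrix with `s τⱼ s'⋆ = ∑ᵢ (adForm s s')ᵢⱼ τᵢ + …`,
where the dots stand for the part outside `su(2)`. Being bilinear over `ℝ`, it makes the adjoint
action `adForm s s` a polynomial in the entries of `s`. -/
def adForm : Matrix (Fin 2) (Fin 2) ℂ →ₗ[ℝ] Matrix (Fin 2) (Fin 2) ℂ →ₗ[ℝ]
    Matrix (Fin 3) (Fin 3) ℝ :=
  LinearMap.mk₂ ℝ (fun s s' => Matrix.of fun i j => tauCoeff (s * tau j * star s') i)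
    (fun s t s' => by ext i j; simp [add_mul])
    (fun c s s' => by ext i j; simp)
    (fun s s' t => by ext i j; simp [mul_add])
    (fun c s s' => by ext i j; simp)

theorem adForm_apply (s s' : Matrix (Fin 2) (Fin 2) ℂ) (i j : Fin 3) :
    adForm s s' i j = tauCoeff (s * tau j * star s') i := rfl

/-- The element of `SU(2)` that corresponds to a quaternion of norm one. -/
def quatMatrix (q : Fin 4 → ℝ) : Matrix (Fin 2) (Fin 2) ℂ :=
  !![q 0 - q 3 * Complex.I, -q 2 - q 1 * Complex.I; q 2 - q 1 * Complex.I, q 0 + q 3 * Complex.I]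

/-- The Euler–Rodrigues matrix of a quaternion. -/
def rotMatrix (q : Fin 4 → ℝ) : Matrix (Fin 3) (Fin 3) ℝ :=
  !![q 0 * q 0 + q 1 * q 1 - q 2 * q 2 - q 3 * q 3, 2 * (q 1 * q 2 - q 0 * q 3),
      2 * (q 1 * q 3 + q 0 * q 2);
    2 * (q 1 * q 2 + q 0 * q 3), q 0 * q 0 - q 1 * q 1 + q 2 * q 2 - q 3 * q 3,
      2 * (q 2 * q 3 - q 0 * q 1);
    2 * (q 1 * q 3 - q 0 * q 2), 2 * (q 2 * q 3 + q 0 * q 1),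
      q 0 * q 0 - q 1 * q 1 - q 2 * q 2 + q 3 * q 3]

/-- The squared norm of a quaternion. -/
def quatNorm (q : Fin 4 → ℝ) : ℝ :=
  q 0 ^ 2 + q 1 ^ 2 + q 2 ^ 2 + q 3 ^ 2

theorem exists_quatMatrix (s : SU2) :
    ∃ q, quatNorm q = 1 ∧ (s : Matrix (Fin 2) (Fin 2) ℂ) = quatMatrix q := by
  obtain ⟨s, hu, hd⟩ := s
  replace hd : s.det = 1 := hd
  have hinv : star s = s.adjugate := by
    have h1 : star s * s = 1 := hu.1
    calc star s = star s * (s * s.adjugate) := by rw [Matrix.mul_adjugate, hd, one_smul, mul_one]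
      _ = s.adjugate := by rw [← mul_assoc, h1, one_mul]
  rw [Matrix.adjugate_fin_two] at hinv
  have h00 : s 1 1 = star (s 0 0) := by simpa using (congr_fun₂ hinv 0 0).symm
  have h01 : s 0 1 = -star (s 1 0) := by
    have := congr_fun₂ hinv 0 1
    simp only [Matrix.star_apply, Matrix.of_apply, Matrix.cons_val', Matrix.cons_val_one,
      Matrix.cons_val_zero, Matrix.cons_val_fin_one] at this
    rw [this, neg_neg]
  refine ⟨![(s 0 0).re, -(s 1 0).im, (s 1 0).re, -(s 0 0).im], ?_, ?_⟩
  · rw [Matrix.det_fin_two, h00, h01] at hd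
    have := congrArg Complex.re hd
    simp at this
    simp [quatNorm]
    linarith
  · ext i j
    fin_cases i <;> fin_cases j <;> simp [quatMatrix, h00, h01, Complex.ext_iff]

theorem quatMatrix_mem {q : Fin 4 → ℝ} (hq : quatNorm q = 1) :
    quatMatrix q ∈ Matrix.specialUnitaryGroup (Fin 2) ℂ := by
  rw [Matrix.mem_specialUnitaryGroup_iff, Matrix.mem_unitaryGroup_iff]
  rw [quatNorm] at hq
  constructor
  · ext i j
    fin_cases i <;> fin_cases j <;>
      simp [quatMatrix, Matrix.mul_apply, Fin.sum_univ_two, Complex.ext_iff] <;>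
      (try constructor) <;> linarith
  · rw [Matrix.det_fin_two]
    simp [quatMatrix, Complex.ext_iff]
    constructor <;> linarith

theorem quatMatrix_conj (q : Fin 4 → ℝ) (j : Fin 3) :
    quatMatrix q * tau j * star (quatMatrix q) = toTau fun i => rotMatrix q i j := by
  rw [toTau_eq]
  ext a b
  fin_cases j <;> fin_cases a <;> fin_cases b <;>
    simp [quatMatrix, rotMatrix, tau, Matrix.mul_apply, Fin.sum_univ_two, Complex.ext_iff] <;>
    constructor <;> ring

theorem adForm_quatMatrix (q : Fin 4 → ℝ) :
    adForm (quatMatrix q) (quatMatrix q) = rotMatrix q := by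
  ext i j
  rw [adForm_apply, quatMatrix_conj, tauCoeff_toTau]

theorem rotMatrix_mul_transpose (q : Fin 4 → ℝ) :
    rotMatrix q * (rotMatrix q)ᵀ = quatNorm q ^ 2 • 1 := by
  ext i j
  fin_cases i <;> fin_cases j <;>
    simp [rotMatrix, quatNorm, Matrix.mul_apply, Fin.sum_univ_three] <;> ring

theorem det_rotMatrix (q : Fin 4 → ℝ) : (rotMatrix q).det = quatNorm q ^ 3 := by
  rw [Matrix.det_fin_three]
  simp [rotMatrix, quatNorm]
  ring

theorem rotMatrix_mem {q : Fin 4 → ℝ} (hq : quatNorm q = 1) :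
    rotMatrix q ∈ Matrix.specialOrthogonalGroup (Fin 3) ℝ := by
  rw [Matrix.mem_specialOrthogonalGroup_iff, Matrix.mem_orthogonalGroup_iff,
    rotMatrix_mul_transpose, det_rotMatrix, hq]
  simp

theorem su2_coe_inv (s : SU2) :
    ((s⁻¹ : SU2) : Matrix (Fin 2) (Fin 2) ℂ) = star (s : Matrix (Fin 2) (Fin 2) ℂ) := rfl

theorem su2_conj_tau (s : SU2) (j : Fin 3) :
    (s : Matrix (Fin 2) (Fin 2) ℂ) * tau j * ((s⁻¹ : SU2) : Matrix (Fin 2) (Fin 2) ℂ)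
      = toTau fun i => adForm s s i j := by
  obtain ⟨q, -, hs⟩ := exists_quatMatrix s
  rw [su2_coe_inv, hs, quatMatrix_conj, adForm_quatMatrix]

/-- The adjoint action of `SU(2)` on its Lie algebra, in terms of coefficient vectors. -/
theorem su2_conj_toTau (s : SU2) (a : Fin 3 → ℝ) :
    (s : Matrix (Fin 2) (Fin 2) ℂ) * toTau a * ((s⁻¹ : SU2) : Matrix (Fin 2) (Fin 2) ℂ)
      = toTau (adForm s s *ᵥ a) := by
  calc _ = ∑ k, a k • toTau fun i => adForm s s i k := by
        simp only [toTau, Finset.mul_sum, Finset.sum_mul, mul_smul_comm, smul_mul_assoc]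
        exact Finset.sum_congr rfl fun k _ => by rw [su2_conj_tau, toTau]
    _ = toTau (adForm s s *ᵥ a) := by
        simp only [toTau, Finset.smul_sum, smul_smul]
        rw [Finset.sum_comm]
        refine Finset.sum_congr rfl fun i _ => ?_
        rw [← Finset.sum_smul]
        congr 1
        exact Finset.sum_congr rfl fun k _ => mul_comm _ _

/-- The homomorphism `SU(2) → SO(3)` given by the adjoint action. -/
def su2ToSO3 : SU2 →* SO3 where
  toFun s := ⟨adForm s s, by
    obtain ⟨q, hq, hs⟩ := exists_quatMatrix s
    rw [hs, adForm_quatMatrix]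
    exact rotMatrix_mem hq⟩
  map_one' := by
    ext i j
    change adForm 1 1 i j = _
    rw [adForm_apply, tauCoeff_apply]
    fin_cases i <;> fin_cases j <;> simp [tau, Matrix.trace_fin_two] <;> norm_num
  map_mul' s t := by
    apply Subtype.ext
    change adForm (s * t : Matrix (Fin 2) (Fin 2) ℂ) (s * t : Matrix (Fin 2) (Fin 2) ℂ)
      = adForm s s * adForm t t
    refine Matrix.ext_iff_mulVec.2 fun a => toTau_injective ?_
    have h := su2_conj_toTau (s * t) a
    rw [mul_inv_rev] at h
    refine h.symm.trans ?_
    rw [← Matrix.mulVec_mulVec, ← su2_conj_toTau, ← su2_conj_toTau]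
    simp only [Submonoid.coe_mul, mul_assoc]

theorem coe_su2ToSO3 (s : SU2) : (su2ToSO3 s : Matrix (Fin 3) (Fin 3) ℝ) = adForm s s := rfl

theorem coe_su2ToSO3_inv (s : SU2) :
    (((su2ToSO3 s)⁻¹ : SO3) : Matrix (Fin 3) (Fin 3) ℝ) = adForm ↑s⁻¹ ↑s⁻¹ := by
  rw [← map_inv, coe_su2ToSO3]

theorem so3_coe_inv (R : SO3) :
    ((R⁻¹ : SO3) : Matrix (Fin 3) (Fin 3) ℝ) = (R : Matrix (Fin 3) (Fin 3) ℝ)ᵀ := by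
  change star (R : Matrix (Fin 3) (Fin 3) ℝ) = _
  rw [Matrix.star_eq_conjTranspose]
  ext i j
  simp

theorem continuous_su2ToSO3 : Continuous su2ToSO3 := by
  refine Continuous.subtype_mk ?_ _
  refine continuous_pi fun i => continuous_pi fun j => ?_
  have : ∀ s : SU2, adForm s s i j = -2 * ((s : Matrix (Fin 2) (Fin 2) ℂ) * tau j *
      star (s : Matrix (Fin 2) (Fin 2) ℂ) * tau i).trace.re := fun s => rfl
  change Continuous fun s : SU2 => adForm s s i j
  simp only [this]
  fun_prop

theorem exists_half_angle {c d : ℝ} (h : c ^ 2 + d ^ 2 = 1) :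
    ∃ p q : ℝ, p ^ 2 + q ^ 2 = 1 ∧ c = p ^ 2 - q ^ 2 ∧ d = 2 * p * q := by
  obtain ⟨z, hz⟩ := IsAlgClosed.exists_eq_mul_self (⟨c, d⟩ : ℂ)
  have hc : c = z.re ^ 2 - z.im ^ 2 := by
    have := congrArg Complex.re hz
    simp only [Complex.mul_re] at this
    linarith
  have hd : d = 2 * z.re * z.im := by
    have := congrArg Complex.im hz
    simp only [Complex.mul_im] at this
    linarith
  refine ⟨z.re, z.im, ?_, hc, hd⟩
  have h2 : (z.re ^ 2 + z.im ^ 2) ^ 2 = 1 := by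
    rw [← h, hc, hd]
    ring
  exact (pow_eq_one_iff_of_nonneg (by positivity) two_ne_zero).1 h2

/-- Rotations about the third axis lie in the image of `SU(2)`. -/
theorem exists_su2_rotZ {c d : ℝ} (h : c ^ 2 + d ^ 2 = 1) :
    ∃ s : SU2, (su2ToSO3 s : Matrix (Fin 3) (Fin 3) ℝ) = !![c, -d, 0; d, c, 0; 0, 0, 1] := by
  obtain ⟨p, q, hpq, rfl, rfl⟩ := exists_half_angle h
  have hq : quatNorm ![p, 0, 0, q] = 1 := by simp [quatNorm, hpq]
  refine ⟨⟨_, quatMatrix_mem hq⟩, ?_⟩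
  rw [coe_su2ToSO3, adForm_quatMatrix]
  ext i j
  fin_cases i <;> fin_cases j <;> simp [rotMatrix] <;> linarith

/-- Rotations about the second axis lie in the image of `SU(2)`. -/
theorem exists_su2_rotY {c d : ℝ} (h : c ^ 2 + d ^ 2 = 1) :
    ∃ s : SU2, (su2ToSO3 s : Matrix (Fin 3) (Fin 3) ℝ) = !![c, 0, d; 0, 1, 0; -d, 0, c] := by
  obtain ⟨p, q, hpq, rfl, rfl⟩ := exists_half_angle h
  have hq : quatNorm ![p, 0, q, 0] = 1 := by simp [quatNorm, hpq]
  refine ⟨⟨_, quatMatrix_mem hq⟩, ?_⟩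
  rw [coe_su2ToSO3, adForm_quatMatrix]
  ext i j
  fin_cases i <;> fin_cases j <;> simp [rotMatrix] <;> linarith

/-- Every rotation is a product of rotations about the third, the second and the third axis
(Euler angles), and these come from `SU(2)`. -/
theorem su2ToSO3_surjective : Function.Surjective su2ToSO3 := by
  intro R
  have hR := (Matrix.mem_orthogonalGroup_iff' (A := (R : Matrix (Fin 3) (Fin 3) ℝ))).1 R.2.1
  set a := (R : Matrix (Fin 3) (Fin 3) ℝ) 0 2 with ha
  set b := (R : Matrix (Fin 3) (Fin 3) ℝ) 1 2 with hb
  set c := (R : Matrix (Fin 3) (Fin 3) ℝ) 2 2 with hc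
  have habc : a ^ 2 + b ^ 2 + c ^ 2 = 1 := by
    have := congr_fun₂ hR 2 2
    simp only [Matrix.mul_apply, Matrix.transpose_apply, Fin.sum_univ_three,
      Matrix.one_apply_eq] at this
    rw [ha, hb, hc]
    linarith
  obtain ⟨ρ, x, y, hxy, ha', hb'⟩ : ∃ ρ x y : ℝ, x ^ 2 + y ^ 2 = 1 ∧ a = ρ * x ∧ b = ρ * y := by
    by_cases h : a ^ 2 + b ^ 2 = 0
    · exact ⟨0, 1, 0, by norm_num, by nlinarith [sq_nonneg b], by nlinarith [sq_nonneg a]⟩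
    · have h0 : 0 < a ^ 2 + b ^ 2 := lt_of_le_of_ne (by positivity) (Ne.symm h)
      have h1 : √(a ^ 2 + b ^ 2) ≠ 0 := (Real.sqrt_pos.2 h0).ne'
      refine ⟨√(a ^ 2 + b ^ 2), a / √(a ^ 2 + b ^ 2), b / √(a ^ 2 + b ^ 2), ?_, ?_, ?_⟩
      · rw [div_pow, div_pow, Real.sq_sqrt h0.le, ← add_div, div_self h]
      · field_simp
      · field_simp
  have hρ : c ^ 2 + ρ ^ 2 = 1 := by
    rw [ha', hb'] at habc
    linear_combination habc - ρ ^ 2 * hxy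
  obtain ⟨s, hs⟩ := exists_su2_rotZ hxy
  obtain ⟨t, ht⟩ := exists_su2_rotY hρ
  -- the rest fixes the third axis
  set T : SO3 := (su2ToSO3 (s * t))⁻¹ * R with hT
  have hTv : (T : Matrix (Fin 3) (Fin 3) ℝ) =
      (!![x, -y, 0; y, x, 0; 0, 0, 1] * !![c, 0, ρ; 0, 1, 0; -ρ, 0, c])ᵀ * R := by
    rw [hT, map_mul, Submonoid.coe_mul, so3_coe_inv, Submonoid.coe_mul, hs, ht]
  have hT2 : ∀ i, (T : Matrix (Fin 3) (Fin 3) ℝ) i 2 = if i = 2 then 1 else 0 := by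
    intro i
    rw [hTv, Matrix.mul_apply, Fin.sum_univ_three, ← ha, ← hb, ← hc, ha', hb']
    fin_cases i <;> simp
    · linear_combination c * ρ * hxy
    · ring
    · linear_combination ρ ^ 2 * hxy + hρ
  have hcol := (Matrix.mem_orthogonalGroup_iff' (A := (T : Matrix (Fin 3) (Fin 3) ℝ))).1 T.2.1
  have hrow := (Matrix.mem_orthogonalGroup_iff (A := (T : Matrix (Fin 3) (Fin 3) ℝ))).1 T.2.1
  have hdet : (T : Matrix (Fin 3) (Fin 3) ℝ).det = 1 := T.2.2
  have h02 := hT2 0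
  have h12 := hT2 1
  have h22 := hT2 2
  have hr := congr_fun₂ hrow 2 2
  have hc0 := congr_fun₂ hcol 0 0
  have hc1 := congr_fun₂ hcol 0 1
  rw [Matrix.det_fin_three] at hdet
  simp only [Matrix.mul_apply, Matrix.transpose_apply, Fin.sum_univ_three, Matrix.one_apply_eq,
    Fin.isValue, Fin.reduceEq, if_true, if_false, ne_eq, not_false_eq_true,
    Matrix.one_apply_ne, zero_ne_one] at hr hc0 hc1 h02 h12 h22
  rw [h22] at hr hdet
  rw [h02, h12] at hdet
  set T' := (T : Matrix (Fin 3) (Fin 3) ℝ) with hT'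
  have h20 : T' 2 0 = 0 := by nlinarith [sq_nonneg (T' 2 0), sq_nonneg (T' 2 1)]
  have h21 : T' 2 1 = 0 := by nlinarith [sq_nonneg (T' 2 0), sq_nonneg (T' 2 1)]
  rw [h20] at hc0 hc1
  have h11 : T' 1 1 = T' 0 0 := by
    linear_combination T' 0 0 * hdet + T' 1 0 * hc1 - T' 1 1 * hc0
  have h01 : T' 0 1 = -T' 1 0 := by
    linear_combination T' 0 0 * hc1 - T' 1 0 * hdet - T' 0 1 * hc0
  obtain ⟨w, hw⟩ := exists_su2_rotZ (c := T' 0 0) (d := T' 1 0) (by linarith)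
  have hwT : su2ToSO3 w = T := by
    apply Subtype.ext
    rw [hw]
    ext i j
    fin_cases i <;> fin_cases j <;> simp [← hT', h01, h11, h02, h12, h20, h21, h22]
  exact ⟨s * t * w, by rw [map_mul, hwT, hT, mul_inv_cancel_left]⟩

section ChartCalculus

/-! ### Calculus in the preferred charts -/

open Filter Topology

variable {M : Type*} [TopologicalSpace M] [ChartedSpace E3 M]
  {F : Type*} [NormedAddCommGroup F] [NormedSpace ℝ F]
  {F' : Type*} [NormedAddCommGroup F'] [NormedSpace ℝ F']
  {F'' : Type*} [NormedAddCommGroup F''] [NormedSpace ℝ F'']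

theorem contMDiffAt_iff_chart {n : ℕ∞ω} {f : M → F} {x : M} [IsManifold 𝓘(ℝ, E3) n M] :
    ContMDiffAt 𝓘(ℝ, E3) 𝓘(ℝ, F) n f x ↔
      ContDiffAt ℝ n (f ∘ (extChartAt 𝓘(ℝ, E3) x).symm) (extChartAt 𝓘(ℝ, E3) x x) := by
  rw [contMDiffAt_iff_source, ModelWithCorners.range_eq_univ, contMDiffWithinAt_univ,
    contMDiffAt_iff_contDiffAt]

theorem d₀_eq_fderiv {f : M → F} {x : M} (hf : MDifferentiableAt 𝓘(ℝ, E3) 𝓘(ℝ, F) f x)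
    (v : E3) :
    d₀ f x v = fderiv ℝ (f ∘ (extChartAt 𝓘(ℝ, E3) x).symm) (extChartAt 𝓘(ℝ, E3) x x) v := by
  have h := hf.mfderiv
  rw [ModelWithCorners.range_eq_univ, fderivWithin_univ] at h
  exact DFunLike.congr_fun h v

theorem eventually_mem_of_isOpen {x : M} {U : Set M} (hU : IsOpen U) (hx : x ∈ U) :
    ∀ᶠ y in 𝓝 (extChartAt 𝓘(ℝ, E3) x x), (extChartAt 𝓘(ℝ, E3) x).symm y ∈ U := by
  refine (continuousAt_extChartAt_symm x).preimage_mem_nhds ?_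
  rw [extChartAt_to_inv]
  exact hU.mem_nhds hx

theorem eventually_mem_target (x : M) :
    ∀ᶠ y in 𝓝 (extChartAt 𝓘(ℝ, E3) x x), y ∈ (extChartAt 𝓘(ℝ, E3) x).target :=
  extChartAt_target_mem_nhds x

section Manifold

variable [IsManifold 𝓘(ℝ, E3) 1 M]

theorem mdifferentiableAt_chart_symm {x : M} {y : E3}
    (hy : y ∈ (extChartAt 𝓘(ℝ, E3) x).target) :
    MDifferentiableAt 𝓘(ℝ, E3) 𝓘(ℝ, E3) (extChartAt 𝓘(ℝ, E3) x).symm y := by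
  have := mdifferentiableWithinAt_extChartAt_symm (I := 𝓘(ℝ, E3)) hy
  rwa [ModelWithCorners.range_eq_univ, mdifferentiableWithinAt_univ] at this

theorem mfderiv_coordVec {x : M} {y : E3} (hy : y ∈ (extChartAt 𝓘(ℝ, E3) x).target) (w : E3) :
    mfderiv 𝓘(ℝ, E3) 𝓘(ℝ, E3) (extChartAt 𝓘(ℝ, E3) x) ((extChartAt 𝓘(ℝ, E3) x).symm y)
      (coordVec x w y) = w := by
  have := mfderiv_extChartAt_comp_mfderivWithin_extChartAt_symm (I := 𝓘(ℝ, E3)) hy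
  rw [ModelWithCorners.range_eq_univ, mfderivWithin_univ] at this
  exact DFunLike.congr_fun this w

theorem coordVec_mfderiv {x : M} {y : E3} (hy : y ∈ (extChartAt 𝓘(ℝ, E3) x).target)
    (v : Tan ((extChartAt 𝓘(ℝ, E3) x).symm y)) :
    coordVec x (mfderiv 𝓘(ℝ, E3) 𝓘(ℝ, E3) (extChartAt 𝓘(ℝ, E3) x)
      ((extChartAt 𝓘(ℝ, E3) x).symm y) v) y = v := by
  have := mfderivWithin_extChartAt_symm_comp_mfderiv_extChartAt (I := 𝓘(ℝ, E3)) hy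
  rw [ModelWithCorners.range_eq_univ, mfderivWithin_univ] at this
  exact DFunLike.congr_fun this v

theorem coordVec_self (x : M) (w : E3) :
    (coordVec x w (extChartAt 𝓘(ℝ, E3) x x) : E3) = w := by
  have := mfderivWithin_range_extChartAt_symm (I := 𝓘(ℝ, E3)) (x := x)
  rw [ModelWithCorners.range_eq_univ, mfderivWithin_univ] at this
  exact DFunLike.congr_fun this w

omit [IsManifold 𝓘(ℝ, E3) 1 M] [NormedAddCommGroup F] [NormedSpace ℝ F] in
theorem form_congr_point (β : ∀ x : M, Tan x → F) {x x' : M} (h : x' = x) (w : E3) :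
    β x' w = β x w := by
  subst h
  rfl

omit [NormedAddCommGroup F] [NormedSpace ℝ F] in
theorem coeff₁_self (β : ∀ x : M, Tan x → F) (x : M) (v : E3) :
    coeff₁ β x v (extChartAt 𝓘(ℝ, E3) x x) = β x v := by
  rw [coeff₁]
  refine Eq.trans ?_ (form_congr_point β (extChartAt_to_inv (I := 𝓘(ℝ, E3)) x) v)
  exact congrArg (β _) (coordVec_self x v)

theorem coordField_self (X : ∀ x : M, Tan x) (x : M) :
    coordField X x (extChartAt 𝓘(ℝ, E3) x x) = X x := by
  have h : ∀ x' : M, x' = x →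
      mfderiv 𝓘(ℝ, E3) 𝓘(ℝ, E3) (extChartAt 𝓘(ℝ, E3) x) x' (X x') = X x := by
    rintro _ rfl
    rw [mfderiv_extChartAt_self]
    rfl
  exact h _ (extChartAt_to_inv (I := 𝓘(ℝ, E3)) x)

/-- The chain rule at every point of the chart domain. -/
theorem d₀_coordVec {f : M → F} {x : M} {y : E3} (hy : y ∈ (extChartAt 𝓘(ℝ, E3) x).target)
    (hf : MDifferentiableAt 𝓘(ℝ, E3) 𝓘(ℝ, F) f ((extChartAt 𝓘(ℝ, E3) x).symm y)) (w : E3) :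
    d₀ f ((extChartAt 𝓘(ℝ, E3) x).symm y) (coordVec x w y)
      = fderiv ℝ (f ∘ (extChartAt 𝓘(ℝ, E3) x).symm) y w := by
  rw [← mfderiv_eq_fderiv, mfderiv_comp y hf (mdifferentiableAt_chart_symm hy)]
  rfl

end Manifold

/-- The components of the 1-form `β` in the chart around `x` are differentiable at `x`. -/
def DiffOneFormAt (β : ∀ x : M, Tan x → F) (x : M) : Prop :=
  ∀ v : E3, DifferentiableAt ℝ (coeff₁ β x v) (extChartAt 𝓘(ℝ, E3) x x)

theorem SmoothOneFormOn.diffAt {β : ∀ x : M, Tan x → F} {U : Set M} (h : SmoothOneFormOn β U)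
    {x : M} (hx : x ∈ U) : DiffOneFormAt β x :=
  fun v => (h x hx v).differentiableAt (by simp)

section Linear

variable [FiniteDimensional ℝ F]

theorem fderiv_linear_comp (φ : F →ₗ[ℝ] F') {f : E3 → F} {y : E3} (hf : DifferentiableAt ℝ f y)
    (u : E3) : fderiv ℝ (fun z => φ (f z)) y u = φ (fderiv ℝ f y u) :=
  DFunLike.congr_fun
    ((LinearMap.toContinuousLinearMap φ).hasFDerivAt.comp y hf.hasFDerivAt).fderiv u

theorem differentiableAt_linear_comp (φ : F →ₗ[ℝ] F') {f : E3 → F} {y : E3}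
    (hf : DifferentiableAt ℝ f y) : DifferentiableAt ℝ (fun z => φ (f z)) y :=
  ((LinearMap.toContinuousLinearMap φ).hasFDerivAt.comp y hf.hasFDerivAt).differentiableAt

theorem DiffOneFormAt.linear_comp (φ : F →ₗ[ℝ] F') {β : ∀ x : M, Tan x → F} {x : M}
    (h : DiffOneFormAt β x) : DiffOneFormAt (fun y w => φ (β y w)) x :=
  fun v => differentiableAt_linear_comp φ (h v)

theorem SmoothOneFormOn.linear_comp (φ : F →ₗ[ℝ] F') {β : ∀ x : M, Tan x → F} {U : Set M}
    (h : SmoothOneFormOn β U) : SmoothOneFormOn (fun y w => φ (β y w)) U :=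
  fun x hx v => (LinearMap.toContinuousLinearMap φ).contDiff.contDiffAt.comp _ (h x hx v)

theorem d₁_linear_comp (φ : F →ₗ[ℝ] F') {β : ∀ x : M, Tan x → F} {x : M}
    (h : DiffOneFormAt β x) (u v : Tan x) :
    d₁ (fun y w => φ (β y w)) x u v = φ (d₁ β x u v) := by
  rw [d₁, d₁, map_sub]
  exact congrArg₂ _ (fderiv_linear_comp φ (h v) u) (fderiv_linear_comp φ (h u) v)

theorem lieDeriv_linear_comp (φ : F →ₗ[ℝ] F') (X : ∀ x : M, Tan x) {β : ∀ x : M, Tan x → F}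
    {x : M} (h : DiffOneFormAt β x) (v : Tan x) :
    lieDeriv X (fun y w => φ (β y w)) x v = φ (lieDeriv X β x v) := by
  rw [lieDeriv, lieDeriv, map_add]
  exact congrArg₂ _ (fderiv_linear_comp φ (h v) (X x)) rfl

theorem d₀_linear_comp (φ : F →ₗ[ℝ] F') {f : M → F} {x : M}
    (hf : MDifferentiableAt 𝓘(ℝ, E3) 𝓘(ℝ, F) f x) (v : Tan x) :
    d₀ (fun y => φ (f y)) x v = φ (d₀ f x v) := by
  rw [d₀, d₀]
  have h := mfderiv_comp x
    (LinearMap.toContinuousLinearMap φ).mdifferentiableAt hf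
  rw [ContinuousLinearMap.mfderiv_eq] at h
  exact DFunLike.congr_fun h v

variable [FiniteDimensional ℝ F']

/-- The product rule for a bilinear product. -/
theorem fderiv_bilinear (B : F →ₗ[ℝ] F' →ₗ[ℝ] F'') {f : E3 → F} {g : E3 → F'} {y : E3}
    (hf : DifferentiableAt ℝ f y) (hg : DifferentiableAt ℝ g y) (u : E3) :
    fderiv ℝ (fun z => B (f z) (g z)) y u
      = B (f y) (fderiv ℝ g y u) + B (fderiv ℝ f y u) (g y) :=
  DFunLike.congr_fun (B.toContinuousBilinearMap.fderiv_of_bilinear hf hg) u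

theorem differentiableAt_bilinear (B : F →ₗ[ℝ] F' →ₗ[ℝ] F'') {f : E3 → F} {g : E3 → F'} {y : E3}
    (hf : DifferentiableAt ℝ f y) (hg : DifferentiableAt ℝ g y) :
    DifferentiableAt ℝ (fun z => B (f z) (g z)) y :=
  (B.toContinuousBilinearMap.hasFDerivAt_of_bilinear hf.hasFDerivAt hg.hasFDerivAt).differentiableAt

theorem contDiffAt_bilinear (B : F →ₗ[ℝ] F' →ₗ[ℝ] F'') {f : E3 → F} {g : E3 → F'} {y : E3}
    {n : ℕ∞ω} (hf : ContDiffAt ℝ n f y) (hg : ContDiffAt ℝ n g y) :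
    ContDiffAt ℝ n (fun z => B (f z) (g z)) y :=
  B.toContinuousBilinearMap.isBoundedBilinearMap.contDiff.contDiffAt.comp y (hf.prodMk hg)

end Linear

/-! ### Matrix-valued forms -/

section MatrixForms

attribute [local instance] Matrix.normedAddCommGroup Matrix.normedSpace

variable {n : Type*} [Fintype n] {𝕂 : Type*} [NormedField 𝕂] [NormedAlgebra ℝ 𝕂]

theorem smoothOneFormOn_matrix {β : ∀ x : M, Tan x → Matrix n n 𝕂} {U : Set M}
    (h : ∀ a b, SmoothOneFormOn (fun y w => β y w a b) U) : SmoothOneFormOn β U :=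
  fun x hx v => contDiffAt_pi.2 fun a => contDiffAt_pi.2 fun b => h a b x hx v

variable [FiniteDimensional ℝ 𝕂]

instance : FiniteDimensional ℝ (Matrix n n 𝕂) := inferInstanceAs (FiniteDimensional ℝ (n → n → 𝕂))

theorem d₁Mat_eq {β : ∀ x : M, Tan x → Matrix n n 𝕂} {x : M} (h : DiffOneFormAt β x)
    (u v : Tan x) : d₁Mat β x u v = d₁ β x u v := by
  ext a b
  exact d₁_linear_comp (Matrix.entryLinearMap ℝ 𝕂 a b) h u v

omit [Fintype n] [FiniteDimensional ℝ 𝕂] in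
theorem d₁Mat_linear_comp [FiniteDimensional ℝ F] (ψ : F →ₗ[ℝ] Matrix n n 𝕂)
    {β : ∀ x : M, Tan x → F} {x : M} (h : DiffOneFormAt β x) (u v : Tan x) :
    d₁Mat (fun y w => ψ (β y w)) x u v = ψ (d₁ β x u v) := by
  ext a b
  exact d₁_linear_comp (Matrix.entryLinearMap ℝ 𝕂 a b ∘ₗ ψ) h u v

omit [Fintype n] [FiniteDimensional ℝ 𝕂] in
theorem lieDerivMat_linear_comp [FiniteDimensional ℝ F] (ψ : F →ₗ[ℝ] Matrix n n 𝕂)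
    (X : ∀ x : M, Tan x) {β : ∀ x : M, Tan x → F} {x : M} (h : DiffOneFormAt β x) (v : Tan x) :
    lieDerivMat X (fun y w => ψ (β y w)) x v = ψ (lieDeriv X β x v) := by
  ext a b
  exact lieDeriv_linear_comp (Matrix.entryLinearMap ℝ 𝕂 a b ∘ₗ ψ) X h v

omit [Fintype n] [FiniteDimensional ℝ 𝕂] in
/-- The derivative of a matrix-valued function `ψ ∘ f`, `ψ` linear. -/
theorem d₀Mat_linear_comp [FiniteDimensional ℝ F] (ψ : F →ₗ[ℝ] Matrix n n 𝕂) {f : M → F} {x : M}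
    (hf : MDifferentiableAt 𝓘(ℝ, E3) 𝓘(ℝ, F) f x) (v : Tan x) :
    d₀Mat (fun y => ψ (f y)) x v = ψ (d₀ f x v) := by
  ext a b
  exact d₀_linear_comp (Matrix.entryLinearMap ℝ 𝕂 a b ∘ₗ ψ) hf v

omit [FiniteDimensional ℝ 𝕂] in
theorem differentiableAt_matrix {f : M → Matrix n n 𝕂} {x : M}
    (hf : ∀ a b, MDifferentiableAt 𝓘(ℝ, E3) 𝓘(ℝ, 𝕂) (fun y => f y a b) x) :
    DifferentiableAt ℝ (f ∘ (extChartAt 𝓘(ℝ, E3) x).symm) (extChartAt 𝓘(ℝ, E3) x x) := by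
  refine differentiableAt_pi.2 fun a => differentiableAt_pi.2 fun b => ?_
  have h := ((mdifferentiableAt_iff _ _).1 (hf a b)).2
  rwa [ModelWithCorners.range_eq_univ, differentiableWithinAt_univ] at h

theorem d₀Mat_eq_fderiv {f : M → Matrix n n 𝕂} {x : M}
    (hf : ∀ a b, MDifferentiableAt 𝓘(ℝ, E3) 𝓘(ℝ, 𝕂) (fun y => f y a b) x) (v : E3) :
    d₀Mat f x v
      = fderiv ℝ (f ∘ (extChartAt 𝓘(ℝ, E3) x).symm) (extChartAt 𝓘(ℝ, E3) x x) v := by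
  ext a b
  exact (d₀_eq_fderiv (hf a b) v).trans
    (fderiv_linear_comp (Matrix.entryLinearMap ℝ 𝕂 a b) (differentiableAt_matrix hf) v)

end MatrixForms

/-! ### Vector fields and Cartan's formula -/

section VectorFields

theorem coeff₁_sum (β : ∀ x : M, Tan x →ₗ[ℝ] F) (x : M) (w : E3) (y : E3) :
    coeff₁ (fun z v => β z v) x w y
      = ∑ a, w a • coeff₁ (fun z v => β z v) x (EuclideanSpace.basisFun (Fin 3) ℝ a) y := by
  have hw : w = ∑ a, w a • EuclideanSpace.basisFun (Fin 3) ℝ a := by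
    simpa using ((EuclideanSpace.basisFun (Fin 3) ℝ).sum_repr w).symm
  have hlin : ∀ w : E3, coeff₁ (fun z v => β z v) x w y = ((β _).comp
      (mfderiv 𝓘(ℝ, E3) 𝓘(ℝ, E3) (extChartAt 𝓘(ℝ, E3) x).symm y).toLinearMap : E3 →ₗ[ℝ] F) w :=
    fun _ => rfl
  simp only [hlin]
  conv_lhs => rw [hw]
  rw [map_sum]
  exact Finset.sum_congr rfl fun a _ => map_smul _ _ _

variable [IsManifold 𝓘(ℝ, E3) ∞ M]

theorem trivializationAt_section {x z : M} (hz : z ∈ (chartAt E3 x).source) (v : Tan z) :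
    (trivializationAt E3 (TangentSpace 𝓘(ℝ, E3)) x ⟨z, v⟩).2
      = (mfderiv 𝓘(ℝ, E3) 𝓘(ℝ, E3) (extChartAt 𝓘(ℝ, E3) x) z v : E3) := by
  have h : (trivializationAt E3 (TangentSpace 𝓘(ℝ, E3)) x).continuousLinearMapAt ℝ z v
      = (trivializationAt E3 (TangentSpace 𝓘(ℝ, E3)) x ⟨z, v⟩).2 := by
    rw [Bundle.Trivialization.continuousLinearMapAt_apply,
      Bundle.Trivialization.linearMapAt_apply, if_pos (by simpa using hz)]
  exact h.symm.trans
    (DFunLike.congr_fun (TangentBundle.continuousLinearMapAt_trivializationAt hz) v)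

/-- A vector field is smooth exactly when its components in the preferred charts are smooth at
the centres of these charts. -/
theorem contMDiff_section_iff (X : ∀ x : M, Tan x) :
    ContMDiff 𝓘(ℝ, E3) (𝓘(ℝ, E3).prod 𝓘(ℝ, E3)) ∞
        (fun x => Bundle.TotalSpace.mk' E3 (E := TangentSpace 𝓘(ℝ, E3)) x (X x)) ↔
      ∀ x, ContDiffAt ℝ ∞ (coordField X x) (extChartAt 𝓘(ℝ, E3) x x) := by
  refine forall_congr' fun x => ?_
  have h : (fun z => (trivializationAt E3 (TangentSpace 𝓘(ℝ, E3)) x ⟨z, X z⟩).2) =ᶠ[𝓝 x]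
      fun z => (mfderiv 𝓘(ℝ, E3) 𝓘(ℝ, E3) (extChartAt 𝓘(ℝ, E3) x) z (X z) : E3) := by
    filter_upwards [(chartAt E3 x).open_source.mem_nhds (mem_chart_source E3 x)] with z hz
    exact trivializationAt_section hz (X z)
  exact (Bundle.contMDiffAt_section x).trans
    (h.contMDiffAt_iff.trans (contMDiffAt_iff_chart (F := E3)))

theorem contDiffAt_coordField (X : SmoothVectorField M) (x : M) :
    ContDiffAt ℝ ∞ (coordField X x) (extChartAt 𝓘(ℝ, E3) x x) :=
  (contMDiff_section_iff X).1 X.contMDiff x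

theorem contraction_eventuallyEq (β : ∀ x : M, Tan x →ₗ[ℝ] F) (X : ∀ x : M, Tan x) (x : M) :
    ((fun z => β z (X z)) ∘ (extChartAt 𝓘(ℝ, E3) x).symm) =ᶠ[𝓝 (extChartAt 𝓘(ℝ, E3) x x)]
      fun y => ∑ a, coordField X x y a •
        coeff₁ (fun z v => β z v) x (EuclideanSpace.basisFun (Fin 3) ℝ a) y := by
  filter_upwards [eventually_mem_target x] with y hy
  rw [← coeff₁_sum, coeff₁, coordField, coordVec_mfderiv hy]
  rfl

omit [IsManifold 𝓘(ℝ, E3) ∞ M] in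
theorem contDiffAt_coordField_apply {X : ∀ x : M, Tan x} {x : M} {n : ℕ∞ω}
    (hX : ContDiffAt ℝ n (coordField X x) (extChartAt 𝓘(ℝ, E3) x x)) (a : Fin 3) :
    ContDiffAt ℝ n (fun y => coordField X x y a) (extChartAt 𝓘(ℝ, E3) x x) :=
  (EuclideanSpace.proj (𝕜 := ℝ) a).contDiff.contDiffAt.comp _ hX

theorem contMDiffAt_contraction {n : ℕ∞ω} [IsManifold 𝓘(ℝ, E3) n M] {β : ∀ x : M, Tan x →ₗ[ℝ] F}
    {X : ∀ x : M, Tan x} {x : M}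
    (hβ : ∀ v, ContDiffAt ℝ n (coeff₁ (fun z v => β z v) x v) (extChartAt 𝓘(ℝ, E3) x x))
    (hX : ContDiffAt ℝ n (coordField X x) (extChartAt 𝓘(ℝ, E3) x x)) :
    ContMDiffAt 𝓘(ℝ, E3) 𝓘(ℝ, F) n (fun z => β z (X z)) x := by
  rw [contMDiffAt_iff_chart]
  refine ContDiffAt.congr_of_eventuallyEq ?_ (contraction_eventuallyEq β X x)
  exact ContDiffAt.sum fun a _ => (contDiffAt_coordField_apply hX a).smul (hβ _)

/-- Cartan's formula `L_X β = i_X dβ + d (i_X β)`. -/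
theorem lieDeriv_eq {β : ∀ x : M, Tan x →ₗ[ℝ] F} {X : ∀ x : M, Tan x} {x : M}
    (hβ : ∀ v, ContDiffAt ℝ 1 (coeff₁ (fun z v => β z v) x v) (extChartAt 𝓘(ℝ, E3) x x))
    (hX : ContDiffAt ℝ 1 (coordField X x) (extChartAt 𝓘(ℝ, E3) x x)) (v : E3) :
    lieDeriv X (fun z w => β z w) x v
      = d₁ (fun z w => β z w) x (X x) v + d₀ (fun z => β z (X z)) x v := by
  set y₀ := extChartAt 𝓘(ℝ, E3) x x with hy₀
  set c := fun a => coeff₁ (fun z v => β z v) x (EuclideanSpace.basisFun (Fin 3) ℝ a) with hc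
  have hXd : DifferentiableAt ℝ (coordField X x) y₀ := hX.differentiableAt one_ne_zero
  have hcd : ∀ v, DifferentiableAt ℝ (coeff₁ (fun z v => β z v) x v) y₀ :=
    fun v => (hβ v).differentiableAt one_ne_zero
  have hXa : ∀ a, HasFDerivAt (fun y => coordField X x y a)
      ((EuclideanSpace.proj (𝕜 := ℝ) a).comp (fderiv ℝ (coordField X x) y₀)) y₀ := fun a =>
    (EuclideanSpace.proj (𝕜 := ℝ) a).hasFDerivAt.comp y₀ hXd.hasFDerivAt
  have h0 : d₀ (fun z => β z (X z)) x v
      = ∑ a, (coordField X x y₀ a • fderiv ℝ (c a) y₀ v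
        + (fderiv ℝ (coordField X x) y₀ v : E3) a • c a y₀) := by
    refine (d₀_eq_fderiv ((contMDiffAt_contraction hβ hX).mdifferentiableAt one_ne_zero) v).trans ?_
    rw [(contraction_eventuallyEq β X x).fderiv_eq,
      (HasFDerivAt.fun_sum fun a _ => (hXa a).fun_smul (hcd _).hasFDerivAt).fderiv,
      sum_apply]
    rfl
  have h1 : ∑ a, (fderiv ℝ (coordField X x) y₀ v : E3) a • c a y₀
      = β x (fderiv ℝ (coordField X x) y₀ v) := by
    rw [← coeff₁_sum]
    exact coeff₁_self (fun z w => β z w) x _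
  have h2 : ∑ a, coordField X x y₀ a • fderiv ℝ (c a) y₀ v
      = fderiv ℝ (coeff₁ (fun z w => β z w) x (X x)) y₀ v := by
    rw [← coordField_self X x]
    have : coeff₁ (fun z w => β z w) x (coordField X x y₀)
        = fun y => ∑ a, coordField X x y₀ a • c a y :=
      funext fun y => coeff₁_sum β x (coordField X x y₀) y
    have hs : HasFDerivAt (fun y => ∑ a, coordField X x y₀ a • c a y)
        (∑ a, coordField X x y₀ a • fderiv ℝ (c a) y₀) y₀ :=
      HasFDerivAt.fun_sum fun a _ => (hcd _).hasFDerivAt.fun_const_smul (coordField X x y₀ a)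
    refine Eq.trans ?_ (congrArg (fun f => fderiv ℝ f y₀ v) this.symm)
    exact (by rw [sum_apply]; rfl :
      ∑ a, coordField X x y₀ a • fderiv ℝ (c a) y₀ v
        = (∑ a, coordField X x y₀ a • fderiv ℝ (c a) y₀) v).trans
      (DFunLike.congr_fun hs.fderiv.symm v)
  have h3 : lieDeriv X (fun z w => β z w) x v = fderiv ℝ (coeff₁ (fun z w => β z w) x v) y₀ (X x)
    + β x (fderiv ℝ (coordField X x) y₀ v) := rfl
  have h4 : d₁ (fun z w => β z w) x (X x) v = fderiv ℝ (coeff₁ (fun z w => β z w) x v) y₀ (X x)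
    - fderiv ℝ (coeff₁ (fun z w => β z w) x (X x)) y₀ v := rfl
  rw [h0, Finset.sum_add_distrib, h1, h2, h3, h4]
  abel

end VectorFields

end ChartCalculus

/-! ### The adjoint action and the cross product -/

theorem su2ToSO3_mulVec_cross (s : SU2) (a b : Fin 3 → ℝ) :
    adForm s s *ᵥ (a ⨯₃ b) = (adForm s s *ᵥ a) ⨯₃ (adForm s s *ᵥ b) := by
  have h : ((s⁻¹ : SU2) : Matrix (Fin 2) (Fin 2) ℂ) * s = 1 :=
    congrArg Subtype.val (inv_mul_cancel s)
  refine toTau_injective ?_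
  rw [← su2_conj_toTau, ← toTau_commutator, ← toTau_commutator, ← su2_conj_toTau, ← su2_conj_toTau,
    mul_sub, sub_mul]
  congr 1
  · calc _ = (s : Matrix (Fin 2) (Fin 2) ℂ) * toTau a * 1 * toTau b * (s⁻¹ : SU2) := by
          simp only [mul_one, mul_assoc]
      _ = _ := by rw [← h]; simp only [mul_assoc]
  · calc _ = (s : Matrix (Fin 2) (Fin 2) ℂ) * toTau b * 1 * toTau a * (s⁻¹ : SU2) := by
          simp only [mul_one, mul_assoc]
      _ = _ := by rw [← h]; simp only [mul_assoc]

theorem adForm_mul_inv (s : SU2) :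
    adForm s s * adForm (s⁻¹ : SU2) (s⁻¹ : SU2) = 1 := by
  rw [← coe_su2ToSO3, ← coe_su2ToSO3, ← Submonoid.coe_mul, ← map_mul, mul_inv_cancel, map_one]
  rfl

theorem adForm_inv_mul (s : SU2) :
    adForm (s⁻¹ : SU2) (s⁻¹ : SU2) * adForm s s = 1 := by
  simpa using adForm_mul_inv s⁻¹

theorem toSpin_conj (s : SU2) (a : Fin 3 → ℝ) :
    adForm s s * toSpin a * adForm (s⁻¹ : SU2) (s⁻¹ : SU2) = toSpin (adForm s s *ᵥ a) := by
  refine Matrix.ext_iff_mulVec.2 fun b => ?_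
  rw [← Matrix.mulVec_mulVec, ← Matrix.mulVec_mulVec, toSpin_mulVec, su2ToSO3_mulVec_cross,
    Matrix.mulVec_mulVec, adForm_mul_inv, Matrix.one_mulVec, toSpin_mulVec]

theorem tau_eq_toTau (j : Fin 3) : tau j = toTau (Pi.single j 1) := by
  simp [toTau, Pi.single_apply, ite_smul]

/-- The differential of the adjoint action: `ad` is `toSpin`. -/
theorem adForm_add_adForm (s : SU2) (ξ : Fin 3 → ℝ) :
    adForm s (s * toTau ξ) + adForm (s * toTau ξ) s = adForm s s * toSpin ξ := by
  ext i j
  have h : (s : Matrix (Fin 2) (Fin 2) ℂ) * tau j * star (s * toTau ξ)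
      + s * toTau ξ * tau j * star (s : Matrix (Fin 2) (Fin 2) ℂ)
      = toTau (adForm s s *ᵥ (ξ ⨯₃ Pi.single j 1)) := by
    rw [← su2_conj_toTau, ← toTau_commutator, su2_coe_inv, star_mul, star_toTau, tau_eq_toTau]
    noncomm_ring
  rw [Matrix.add_apply, adForm_apply, adForm_apply, ← Pi.add_apply, ← map_add, h, tauCoeff_toTau,
    ← toSpin_mulVec, Matrix.mulVec_mulVec, Matrix.mulVec_single_one]
  rfl

/-! ### Covariance of the curvature -/

/-- The algebra behind the covariance of the curvature: `a`, `b` are two components of the gauge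
field, `b'`, `a'` their derivatives, `p`, `q` the derivatives of the transition function `g` and `h`
its mixed second derivative. -/
theorem curvature_algebra {R : Type*} [Ring R] {s g a b a' b' p q h : R} (hgs : g * s = 1) :
    (s * (b * p + b' * g + h) - s * p * s * (b * g + q))
        - (s * (a * q + a' * g + h) - s * q * s * (a * g + p))
        + (s * (a * g + p) * (s * (b * g + q)) - s * (b * g + q) * (s * (a * g + p)))
      = s * ((b' - a') + (a * b - b * a)) * g := by
  have h1 : ∀ c d : R, s * (c * g + d) = s * c * g + s * d := fun c d => by noncomm_ring
  have h2 : ∀ c d : R, c * g * (s * d) = c * d := fun c d => by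
    rw [mul_assoc, ← mul_assoc g, hgs, one_mul]
  have h3 : ∀ c d e f : R, s * (c * g + d) * (s * (e * g + f))
      = s * c * e * g + s * c * f + s * d * s * (e * g + f) := fun c d e f => by
    rw [h1 c d, add_mul, h2]
    noncomm_ring
  rw [h3, h3]
  noncomm_ring

section Covariance

open Filter Topology

section Bilinear

variable {F : Type*} [NormedAddCommGroup F] [NormedSpace ℝ F]

theorem fderiv_fderiv_apply {g : E3 → F} {y : E3} (hg : DifferentiableAt ℝ (fderiv ℝ g) y)
    (a b : E3) : fderiv ℝ (fun z => fderiv ℝ g z b) y a = fderiv ℝ (fderiv ℝ g) y a b := by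
  rw [(hg.hasFDerivAt.clm_apply (hasFDerivAt_const b y)).fderiv]
  simp

variable [FiniteDimensional ℝ F] (B : F →ₗ[ℝ] F →ₗ[ℝ] F)

theorem bilinear_fderiv_add_eq_zero {s g : E3 → F} {y : E3} {k : F}
    (hs : DifferentiableAt ℝ s y) (hg : DifferentiableAt ℝ g y)
    (h : (fun z => B (s z) (g z)) =ᶠ[𝓝 y] fun _ => k) (w : E3) :
    B (s y) (fderiv ℝ g y w) + B (fderiv ℝ s y w) (g y) = 0 := by
  rw [← fderiv_bilinear B hs hg, h.fderiv_eq, fderiv_fun_const]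
  rfl

/-- The derivative of a component of a gauge-transformed gauge field. -/
theorem fderiv_gauge_transform {s g c f : E3 → F} {y : E3}
    (hs : DifferentiableAt ℝ s y) (hg : DifferentiableAt ℝ g y) (hc : DifferentiableAt ℝ c y)
    (hg2 : DifferentiableAt ℝ (fderiv ℝ g) y) {b : E3}
    (hf : f =ᶠ[𝓝 y] fun z => B (s z) (B (c z) (g z) + fderiv ℝ g z b)) (a : E3) :
    fderiv ℝ f y a
      = B (s y) (B (c y) (fderiv ℝ g y a) + B (fderiv ℝ c y a) (g y)
          + fderiv ℝ (fderiv ℝ g) y a b)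
        + B (fderiv ℝ s y a) (B (c y) (g y) + fderiv ℝ g y b) := by
  have h1 : DifferentiableAt ℝ (fun z => fderiv ℝ g z b) y :=
    hg2.clm_apply (differentiableAt_const b)
  have h2 := differentiableAt_bilinear B hc hg
  rw [hf.fderiv_eq, fderiv_bilinear B hs (h2.fun_add h1), fderiv_fun_add h2 h1,
    add_apply, fderiv_bilinear B hc hg, fderiv_fderiv_apply hg2]

end Bilinear

attribute [local instance] Matrix.normedAddCommGroup Matrix.normedSpace

variable {G : Type*} [Group G] [TopologicalSpace G]
  {n : Type*} [Fintype n] [DecidableEq n] {𝕂 : Type*} [NormedField 𝕂] [NormedAlgebra ℝ 𝕂]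
  {r : G →* Matrix n n 𝕂} {M : Type*} [TopologicalSpace M] [ChartedSpace E3 M] {ι : Type*}

theorem PrincipalBundle.t_inv (P : PrincipalBundle r M ι) {i j : ι} {x : M}
    (hx : x ∈ P.U i ∩ P.U j) : P.t j i x = (P.t i j x)⁻¹ := by
  rw [eq_inv_iff_mul_eq_one, P.t_mul j i j x ⟨⟨hx.2, hx.1⟩, hx.2⟩, P.t_self j x hx.2]

theorem PrincipalBundle.contDiffAt_t [IsManifold 𝓘(ℝ, E3) ∞ M] (P : PrincipalBundle r M ι)
    {i j : ι} {x : M} (hx : x ∈ P.U i ∩ P.U j) :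
    ContDiffAt ℝ ∞ ((fun y => r (P.t i j y)) ∘ (extChartAt 𝓘(ℝ, E3) x).symm)
      (extChartAt 𝓘(ℝ, E3) x x) := by
  refine contDiffAt_pi.2 fun a => contDiffAt_pi.2 fun b => ?_
  exact contMDiffAt_iff_chart.1 ((P.smooth_t i j a b).contMDiffAt
    (((P.isOpen_U i).inter (P.isOpen_U j)).mem_nhds hx))

theorem PrincipalBundle.mdifferentiableAt_t (P : PrincipalBundle r M ι) {i j : ι} {x : M}
    (hx : x ∈ P.U i ∩ P.U j) (a b : n) :
    MDifferentiableAt 𝓘(ℝ, E3) 𝓘(ℝ, 𝕂) (fun y => r (P.t i j y) a b) x :=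
  ((P.smooth_t i j a b).contMDiffAt
    (((P.isOpen_U i).inter (P.isOpen_U j)).mem_nhds hx)).mdifferentiableAt (by simp)

variable [FiniteDimensional ℝ 𝕂] [IsManifold 𝓘(ℝ, E3) ∞ M] {P : PrincipalBundle r M ι}
  {𝔤 : Submodule ℝ (Matrix n n 𝕂)}

omit [FiniteDimensional ℝ 𝕂] [IsManifold 𝓘(ℝ, E3) ∞ M] in
theorem Connection.smoothOneFormOn (H : Connection P 𝔤) (i : ι) :
    SmoothOneFormOn (fun x v => H.form i x v) (P.U i) :=
  smoothOneFormOn_matrix (H.smooth i)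

omit [FiniteDimensional ℝ 𝕂] [IsManifold 𝓘(ℝ, E3) ∞ M] in
theorem Connection.diffAt (H : Connection P 𝔤) {i : ι} {x : M} (hx : x ∈ P.U i) :
    DiffOneFormAt (fun x v => H.form i x v) x :=
  (H.smoothOneFormOn i).diffAt hx

omit [DecidableEq n] in
theorem d₀Mat_coordVec {f : M → Matrix n n 𝕂} {x : M} {y : E3}
    (hy : y ∈ (extChartAt 𝓘(ℝ, E3) x).target)
    (hf : ∀ a b, MDifferentiableAt 𝓘(ℝ, E3) 𝓘(ℝ, 𝕂) (fun z => f z a b)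
      ((extChartAt 𝓘(ℝ, E3) x).symm y))
    (hf' : DifferentiableAt ℝ (f ∘ (extChartAt 𝓘(ℝ, E3) x).symm) y) (w : E3) :
    d₀Mat f ((extChartAt 𝓘(ℝ, E3) x).symm y) (coordVec x w y)
      = fderiv ℝ (f ∘ (extChartAt 𝓘(ℝ, E3) x).symm) y w := by
  ext a b
  exact (d₀_coordVec hy (hf a b) w).trans
    (fderiv_linear_comp (Matrix.entryLinearMap ℝ 𝕂 a b) hf' w)

/-- The curvatures in two trivializations are conjugate under the transition function. -/
theorem Connection.curvature_glue (H : Connection P 𝔤) {i j : ι} {x : M}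
    (hx : x ∈ P.U i ∩ P.U j) (u v : E3) :
    curvature (fun y w => H.form j y w) x u v
      = r (P.t i j x)⁻¹ * curvature (fun y w => H.form i y w) x u v * r (P.t i j x) := by
  set y₀ := extChartAt 𝓘(ℝ, E3) x x with hy₀
  set g : E3 → Matrix n n 𝕂 := (fun y => r (P.t i j y)) ∘ (extChartAt 𝓘(ℝ, E3) x).symm with hg
  set s : E3 → Matrix n n 𝕂 := (fun y => r (P.t j i y)) ∘ (extChartAt 𝓘(ℝ, E3) x).symm with hs
  set c : E3 → E3 → Matrix n n 𝕂 := coeff₁ (fun y w => H.form i y w) x with hc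
  have hgC : ContDiffAt ℝ ∞ g y₀ := P.contDiffAt_t hx
  have hgd : DifferentiableAt ℝ g y₀ := hgC.differentiableAt (by simp)
  have hsd : DifferentiableAt ℝ s y₀ := (P.contDiffAt_t ⟨hx.2, hx.1⟩).differentiableAt (by simp)
  have hcd : ∀ w, DifferentiableAt ℝ (c w) y₀ := H.diffAt hx.1
  have hg2 : DifferentiableAt ℝ (fderiv ℝ g) y₀ :=
    (hgC.fderiv_right (m := 1) (by norm_cast)).differentiableAt one_ne_zero
  have hpt : (extChartAt 𝓘(ℝ, E3) x).symm y₀ = x := extChartAt_to_inv x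
  have hg0 : g y₀ = r (P.t i j x) := by rw [hg, Function.comp_apply, hpt]
  have hs0 : s y₀ = r (P.t i j x)⁻¹ := by rw [hs, Function.comp_apply, hpt, P.t_inv hx]
  have hov := eventually_mem_of_isOpen ((P.isOpen_U i).inter (P.isOpen_U j)) hx
  have hgs : g y₀ * s y₀ = 1 := by rw [hg0, hs0, ← map_mul, mul_inv_cancel, map_one]
  have hsg : ∀ᶠ y in 𝓝 y₀, s y * g y = 1 := by
    filter_upwards [hov] with y hy
    rw [hs, hg, Function.comp_apply, Function.comp_apply, P.t_inv hy, ← map_mul, inv_mul_cancel,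
      map_one]
  -- the derivative of the inverse
  have hds : ∀ w, fderiv ℝ s y₀ w = -(s y₀ * fderiv ℝ g y₀ w * s y₀) := by
    intro w
    have h : s y₀ * fderiv ℝ g y₀ w + fderiv ℝ s y₀ w * g y₀ = 0 :=
      bilinear_fderiv_add_eq_zero (LinearMap.mul ℝ (Matrix n n 𝕂)) hsd hgd hsg w
    calc fderiv ℝ s y₀ w = fderiv ℝ s y₀ w * g y₀ * s y₀ := by rw [mul_assoc, hgs, mul_one]
      _ = _ := by rw [eq_neg_of_add_eq_zero_right h, neg_mul]
  -- the gluing condition in coordinates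
  have hcj : ∀ w : E3, coeff₁ (fun y w => H.form j y w) x w
      =ᶠ[𝓝 y₀] fun y => s y * (c w y * g y + fderiv ℝ g y w) := by
    intro w
    have hgd' : ∀ᶠ y in 𝓝 y₀, DifferentiableAt ℝ g y :=
      ((hgC.of_le (m := 1) (by norm_cast)).eventually (by simp)).mono
        fun y hy => hy.differentiableAt one_ne_zero
    filter_upwards [hov, eventually_mem_target x, hgd'] with y hy hy' hyd
    have h := H.glue i j _ hy (coordVec x w y)
    rw [d₀Mat_coordVec hy' (fun a b => P.mdifferentiableAt_t hy a b) hyd, ← P.t_inv hy] at h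
    refine h.trans ?_
    rw [mul_add, ← mul_assoc]
    rfl
  have hform : ∀ w : E3, H.form j x w = s y₀ * (H.form i x w * g y₀ + fderiv ℝ g y₀ w) := by
    intro w
    have h1 := coeff₁_self (fun y w => H.form j y w) x w
    have h2 : c w y₀ = H.form i x w := coeff₁_self (fun y w => H.form i y w) x w
    rw [← h2]
    exact h1.symm.trans (hcj w).eq_of_nhds
  have hder : ∀ a b : E3, fderiv ℝ (coeff₁ (fun y w => H.form j y w) x b) y₀ a
      = s y₀ * (H.form i x b * fderiv ℝ g y₀ a + fderiv ℝ (c b) y₀ a * g y₀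
          + fderiv ℝ (fderiv ℝ g) y₀ a b)
        - s y₀ * fderiv ℝ g y₀ a * s y₀ * (H.form i x b * g y₀ + fderiv ℝ g y₀ b) := by
    intro a b
    have h2 : c b y₀ = H.form i x b := coeff₁_self (fun y w => H.form i y w) x b
    have h3 : fderiv ℝ (coeff₁ (fun y w => H.form j y w) x b) y₀ a
        = s y₀ * (c b y₀ * fderiv ℝ g y₀ a + fderiv ℝ (c b) y₀ a * g y₀
            + fderiv ℝ (fderiv ℝ g) y₀ a b)
          + fderiv ℝ s y₀ a * (c b y₀ * g y₀ + fderiv ℝ g y₀ b) :=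
      fderiv_gauge_transform (LinearMap.mul ℝ (Matrix n n 𝕂)) hsd hgd (hcd b) hg2 (hcj b) a
    rw [h3, hds, h2, neg_mul, ← sub_eq_add_neg]
  have hsymm : fderiv ℝ (fderiv ℝ g) y₀ v u = fderiv ℝ (fderiv ℝ g) y₀ u v :=
    (hgC.isSymmSndFDerivAt (by
      rw [minSmoothness_of_isRCLikeNormedField]
      exact WithTop.coe_le_coe.2 le_top)).eq v u
  have hcurv : ∀ k, x ∈ P.U k → curvature (fun y w => H.form k y w) x u v
      = fderiv ℝ (coeff₁ (fun y w => H.form k y w) x v) y₀ u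
        - fderiv ℝ (coeff₁ (fun y w => H.form k y w) x u) y₀ v
        + (H.form k x u * H.form k x v - H.form k x v * H.form k x u) :=
    fun k hk => congrArg (· + (H.form k x u * H.form k x v - H.form k x v * H.form k x u))
      (d₁Mat_eq (H.diffAt hk) u v)
  refine (hcurv j hx.2).trans ?_
  rw [hcurv i hx.1, ← hs0, ← hg0, hder u v, hder v u, hsymm, hform u, hform v]
  exact curvature_algebra hgs

end Covariance

/-! ### The coframe bundle of a gauge field -/

section Construction

open Filter Topology

attribute [local instance] Matrix.normedAddCommGroup Matrix.normedSpace

variable {M : Type*} [TopologicalSpace M] [ChartedSpace E3 M] {ι : Type*}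

/-- The second factor of the transition functions, as a matrix-valued function. -/
def diagTransition (P : GaugeBundle M ι) (i j : ι) (y : M) : Matrix (Fin 2) (Fin 2) ℂ :=
  ((P.t i j y).2 : Matrix (Fin 2) (Fin 2) ℂ)

theorem contDiffAt_diagTransition [IsManifold 𝓘(ℝ, E3) ∞ M] (P : GaugeBundle M ι) {i j : ι}
    {x : M} (hx : x ∈ P.U i ∩ P.U j) :
    ContDiffAt ℝ ∞ (diagTransition P i j ∘ (extChartAt 𝓘(ℝ, E3) x).symm)
      (extChartAt 𝓘(ℝ, E3) x x) := by
  refine contDiffAt_pi.2 fun a => contDiffAt_pi.2 fun b => ?_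
  exact contMDiffAt_iff_chart.1 ((P.smooth_t i j (Sum.inr a) (Sum.inr b)).contMDiffAt
    (((P.isOpen_U i).inter (P.isOpen_U j)).mem_nhds hx))

/-- The principal `SO(3)`-bundle obtained by transporting the transition functions of the
`SU(2)`-subbundle along `SU(2) → SO(3)`. -/
def so3Bundle [IsManifold 𝓘(ℝ, E3) ∞ M] (P : GaugeBundle M ι) : PrincipalBundle so3Rep M ι where
  U := P.U
  isOpen_U := P.isOpen_U
  indexAt := P.indexAt
  mem_indexAt := P.mem_indexAt
  t i j x := su2ToSO3 (P.t i j x).2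
  t_self i x hx := by rw [P.t_self i x hx, Prod.snd_one, map_one]
  t_mul i j k x hx := by rw [← map_mul, ← Prod.snd_mul, P.t_mul i j k x hx]
  continuousOn_t i j := continuous_su2ToSO3.comp_continuousOn
    (continuous_snd.comp_continuousOn (P.continuousOn_t i j))
  smooth_t i j a b := by
    intro x hx
    refine ContMDiffAt.contMDiffWithinAt (contMDiffAt_iff_chart.2 ?_)
    have h := contDiffAt_diagTransition P hx
    have h2 := contDiffAt_bilinear adForm h h
    exact (LinearMap.toContinuousLinearMap
      (Matrix.entryLinearMap ℝ ℝ a b : Matrix (Fin 3) (Fin 3) ℝ →ₗ[ℝ] ℝ)).contDiff.contDiffAt.comp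
        _ h2

theorem d₀Mat_congr {n : Type*} {𝕂 : Type*} [NormedField 𝕂] [NormedAlgebra ℝ 𝕂]
    {f g : M → Matrix n n 𝕂} {x : M} (h : f =ᶠ[𝓝 x] g) (v : Tan x) :
    d₀Mat f x v = d₀Mat g x v := by
  ext a b
  have : (fun y => f y a b) =ᶠ[𝓝 x] fun y => g y a b :=
    h.mono fun y hy => congrArg (fun A => A a b) hy
  exact DFunLike.congr_fun this.mfderiv_eq v

variable {P : GaugeBundle M ι}

theorem d₀Mat_gaugeRep (hP : IsSplit P) {i j : ι} {x : M} (hx : x ∈ P.U i ∩ P.U j) (v : Tan x) :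
    d₀Mat (fun y => gaugeRep (P.t i j y)) x v
      = Matrix.fromBlocks (d₀Mat (diagTransition P i j) x v) 0 0
        (d₀Mat (diagTransition P i j) x v) := by
  have h : (fun y => ((P.t i j y).1 : Matrix (Fin 2) (Fin 2) ℂ)) =ᶠ[𝓝 x]
      diagTransition P i j := by
    filter_upwards [((P.isOpen_U i).inter (P.isOpen_U j)).mem_nhds hx] with y hy
    rw [hP i j y hy]
    rfl
  have h0 : d₀ (fun _ : M => (0 : ℂ)) x v = 0 :=
    DFunLike.congr_fun (mfderiv_const (I := 𝓘(ℝ, E3)) (I' := 𝓘(ℝ, ℂ))) v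
  rw [← Matrix.fromBlocks_toBlocks (d₀Mat (fun y => gaugeRep (P.t i j y)) x v)]
  congr 1
  · exact d₀Mat_congr h v
  · ext a b
    exact h0
  · ext a b
    exact h0

theorem GaugeField.form_eq (H : GaugeField P) {i : ι} {x : M} (hx : x ∈ P.U i) (v : Tan x) :
    H.form i x v = toL (H.A i x v) + toQ (H.θ i x v) :=
  eq_toL_add_toQ (H.mem i x hx v)

theorem su2_conj_inv_toTau (s : SU2) (a : Fin 3 → ℝ) :
    ((s⁻¹ : SU2) : Matrix (Fin 2) (Fin 2) ℂ) * toTau a * (s : Matrix (Fin 2) (Fin 2) ℂ)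
      = toTau (adForm (s⁻¹ : SU2) (s⁻¹ : SU2) *ᵥ a) := by
  simpa using su2_conj_toTau s⁻¹ a

/-- The gluing conditions for the two components of the gauge field: `θ` transforms as a vector,
`A` as a connection. Since the difference of `A` in the two trivializations is the derivative of
the transition function `s`, this derivative takes values in `s · su(2)`. -/
theorem GaugeField.glue_components (hP : IsSplit P) (H : GaugeField P) {i j : ι} {x : M}
    (hx : x ∈ P.U i ∩ P.U j) (v : Tan x) :
    ∃ ξ, d₀Mat (diagTransition P i j) x v = (P.t i j x).2 * toTau ξ ∧
      H.A j x v = adForm ((P.t i j x).2⁻¹ : SU2) ((P.t i j x).2⁻¹ : SU2) *ᵥ H.A i x v + ξ ∧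
      H.θ j x v = adForm ((P.t i j x).2⁻¹ : SU2) ((P.t i j x).2⁻¹ : SU2) *ᵥ H.θ i x v := by
  have hg := H.glue i j x hx v
  rw [H.form_eq hx.1, H.form_eq hx.2, d₀Mat_gaugeRep hP hx, toL_add_toQ, toL_add_toQ] at hg
  have ht : P.t i j x = ((P.t i j x).2, (P.t i j x).2) := Prod.ext (hP i j x hx) rfl
  set s := (P.t i j x).2 with hs
  set D := d₀Mat (diagTransition P i j) x v
  rw [ht] at hg
  have hinv : gaugeRep (s, s)⁻¹ = Matrix.fromBlocks ((s⁻¹ : SU2) : Matrix (Fin 2) (Fin 2) ℂ) 0 0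
      ((s⁻¹ : SU2) : Matrix (Fin 2) (Fin 2) ℂ) := rfl
  have hrep : gaugeRep (s, s) = Matrix.fromBlocks (s : Matrix (Fin 2) (Fin 2) ℂ) 0 0
      (s : Matrix (Fin 2) (Fin 2) ℂ) := rfl
  rw [hinv, hrep, Matrix.fromBlocks_multiply, Matrix.fromBlocks_multiply,
    Matrix.fromBlocks_multiply, Matrix.fromBlocks_add] at hg
  simp only [mul_zero, zero_mul, add_zero, zero_add] at hg
  obtain ⟨h1, -, -, h2⟩ := Matrix.fromBlocks_inj.1 hg
  rw [su2_conj_inv_toTau] at h1 h2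
  set S := adForm ((s⁻¹ : SU2) : Matrix (Fin 2) (Fin 2) ℂ) ((s⁻¹ : SU2) : Matrix (Fin 2) (Fin 2) ℂ)
  set ξ := H.A j x v - H.θ j x v - S *ᵥ (H.A i x v - H.θ i x v) with hξ
  have hD : ((s⁻¹ : SU2) : Matrix (Fin 2) (Fin 2) ℂ) * D = toTau ξ := by
    rw [hξ, toTau_sub, h2]
    abel
  rw [hD, ← toTau_add] at h1
  replace h1 := toTau_injective h1
  have hsum := h1
  rw [Matrix.mulVec_add] at hsum
  rw [Matrix.mulVec_sub] at hξ
  have hθ : H.θ j x v = S *ᵥ H.θ i x v := by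
    funext k
    have e1 := congrFun hsum k
    have e2 := congrFun hξ k
    simp only [Pi.add_apply, Pi.sub_apply] at e1 e2
    linarith
  refine ⟨ξ, ?_, ?_, hθ⟩
  · have h1s : (s : Matrix (Fin 2) (Fin 2) ℂ) * ((s⁻¹ : SU2) : Matrix (Fin 2) (Fin 2) ℂ) = 1 :=
      congrArg Subtype.val (mul_inv_cancel s)
    rw [← hD, ← mul_assoc, h1s, one_mul]
  · rw [hξ, hθ]
    abel

theorem d₀Mat_adForm {s : M → SU2} {x : M} {ξ : Fin 3 → ℝ} {v : E3}
    (hs : ∀ a b, MDifferentiableAt 𝓘(ℝ, E3) 𝓘(ℝ, ℂ)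
      (fun y => (s y : Matrix (Fin 2) (Fin 2) ℂ) a b) x)
    (hR : ∀ a b, MDifferentiableAt 𝓘(ℝ, E3) 𝓘(ℝ, ℝ) (fun y => adForm (s y) (s y) a b) x)
    (h : d₀Mat (fun y => (s y : Matrix (Fin 2) (Fin 2) ℂ)) x v = s x * toTau ξ) :
    d₀Mat (fun y => adForm (s y) (s y)) x v = adForm (s x) (s x) * toSpin ξ := by
  have hd := differentiableAt_matrix hs
  have hp : (extChartAt 𝓘(ℝ, E3) x).symm (extChartAt 𝓘(ℝ, E3) x x) = x := extChartAt_to_inv x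
  have h1 := fderiv_bilinear adForm hd hd v
  rw [d₀Mat_eq_fderiv hs] at h
  rw [d₀Mat_eq_fderiv hR, ← adForm_add_adForm, ← h]
  refine h1.trans ?_
  rw [Function.comp_apply, hp]
  rfl

variable [IsManifold 𝓘(ℝ, E3) ∞ M]

omit [IsManifold 𝓘(ℝ, E3) ∞ M] in
theorem GaugeField.smooth_A (H : GaugeField P) (i : ι) :
    SmoothOneFormOn (fun x v => H.A i x v) (P.U i) :=
  (H.smoothOneFormOn i).linear_comp compLLinear

omit [IsManifold 𝓘(ℝ, E3) ∞ M] in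
theorem GaugeField.smooth_θ (H : GaugeField P) (i : ι) :
    SmoothOneFormOn (fun x v => H.θ i x v) (P.U i) :=
  (H.smoothOneFormOn i).linear_comp compQLinear

/-- The spin connection `ω_{jk} = -ε_{jkl} Aˡ` on the `SO(3)`-bundle. -/
def spinConnection (hP : IsSplit P) (H : GaugeField P) : Connection (so3Bundle P) so3 where
  form i x := toSpinLinear ∘ₗ compLLinear ∘ₗ H.form i x
  mem i x _ v := toSpin_mem _
  smooth i a b := (H.smooth_A i).linear_comp (Matrix.entryLinearMap ℝ ℝ a b ∘ₗ toSpinLinear)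
  glue i j x hx v := by
    obtain ⟨ξ, hξ, hA, -⟩ := H.glue_components hP hx v
    have hd : d₀Mat (fun y => so3Rep ((so3Bundle P).t i j y)) x v
        = adForm (P.t i j x).2 (P.t i j x).2 * toSpin ξ :=
      d₀Mat_adForm (s := fun y => (P.t i j y).2)
        (fun a b => P.mdifferentiableAt_t hx (Sum.inr a) (Sum.inr b))
        (fun a b => (so3Bundle P).mdifferentiableAt_t hx a b) hξ
    rw [hd]
    have hinv : so3Rep ((so3Bundle P).t i j x)⁻¹
        = adForm ((P.t i j x).2⁻¹ : SU2) ((P.t i j x).2⁻¹ : SU2) :=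
      coe_su2ToSO3_inv _
    have hrep : so3Rep ((so3Bundle P).t i j x) = adForm (P.t i j x).2 (P.t i j x).2 := rfl
    have hc := toSpin_conj (P.t i j x).2⁻¹ (H.A i x v)
    rw [inv_inv] at hc
    rw [hinv, hrep, ← mul_assoc, adForm_inv_mul, one_mul]
    change toSpin (H.A j x v) = _ * toSpin (H.A i x v) * _ + _
    rw [hc, hA]
    exact toSpinLinear.map_add _ _

omit [IsManifold 𝓘(ℝ, E3) ∞ M] in
theorem finrank_tan (x : M) : Module.finrank ℝ (Tan x) = 3 :=
  finrank_euclideanSpace_fin (𝕜 := ℝ) (n := 3)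

instance (x : M) : FiniteDimensional ℝ (Tan x) := inferInstanceAs (FiniteDimensional ℝ E3)

/-- The coframe bundle of a gauge field: the spin connection is `A`, the dreibein is `θ / μ`. -/
def coframe (hP : IsSplit P) (H : GaugeField P) (hH : ∀ i, ∀ x ∈ P.U i, ∀ v, H.θ i x v = 0 → v = 0)
    {μ : ℝ} (hμ : μ ≠ 0) : CoframeBundle M ι where
  toPrincipalBundle := so3Bundle P
  spin := spinConnection hP H
  e i x := μ⁻¹ • (compQLinear ∘ₗ H.form i x)
  smooth_e i := (H.smooth_θ i).linear_comp (μ⁻¹ • LinearMap.id)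
  bijective_e i x hx := by
    have hinj : Function.Injective (μ⁻¹ • (compQLinear ∘ₗ H.form i x) : Tan x →ₗ[ℝ] _) := by
      refine (injective_iff_map_eq_zero _).2 fun v hv => hH i x hx v ?_
      exact (smul_eq_zero.1 hv).resolve_left (inv_ne_zero hμ)
    refine ⟨hinj, (LinearMap.injective_iff_surjective_of_finrank_eq_finrank
      ?_).1 hinj⟩
    rw [finrank_tan]
    simp
  glue_e i j x hx v := by
    obtain ⟨ξ, -, -, hθ⟩ := H.glue_components hP hx v
    change μ⁻¹ • H.θ j x v = _ *ᵥ (μ⁻¹ • H.θ i x v)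
    rw [Matrix.mulVec_smul, hθ]
    congr 2
    exact (coe_su2ToSO3_inv _).symm

end Construction

section FieldStrength

open Filter Topology

attribute [local instance] Matrix.normedAddCommGroup Matrix.normedSpace

variable {M : Type*} [TopologicalSpace M] [ChartedSpace E3 M] {ι : Type*} {P : GaugeBundle M ι}

/-! ### The field strength -/

theorem compL_add (Z W : Matrix (Fin 2 ⊕ Fin 2) (Fin 2 ⊕ Fin 2) ℂ) :
    compL (Z + W) = compL Z + compL W :=
  compLLinear.map_add Z W

theorem compQ_add (Z W : Matrix (Fin 2 ⊕ Fin 2) (Fin 2 ⊕ Fin 2) ℂ) :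
    compQ (Z + W) = compQ Z + compQ W :=
  compQLinear.map_add Z W

theorem GaugeField.compL_d₁Mat (H : GaugeField P) {i : ι} {x : M} (hx : x ∈ P.U i)
    (u v : Tan x) :
    compL (d₁Mat (fun y w => H.form i y w) x u v) = d₁ (fun y w => H.A i y w) x u v := by
  rw [d₁Mat_eq (H.diffAt hx)]
  exact (d₁_linear_comp compLLinear (H.diffAt hx) u v).symm

theorem GaugeField.compQ_d₁Mat (H : GaugeField P) {i : ι} {x : M} (hx : x ∈ P.U i)
    (u v : Tan x) :
    compQ (d₁Mat (fun y w => H.form i y w) x u v) = d₁ (fun y w => H.θ i y w) x u v := by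
  rw [d₁Mat_eq (H.diffAt hx)]
  exact (d₁_linear_comp compQLinear (H.diffAt hx) u v).symm

theorem GaugeField.compL_K (H : GaugeField P) {i : ι} {x : M} (hx : x ∈ P.U i) (u v : Tan x) :
    compL (H.K i x u v) = d₁ (fun y w => H.A i y w) x u v
      + (H.A i x u ⨯₃ H.A i x v + H.θ i x u ⨯₃ H.θ i x v) := by
  rw [GaugeField.K, curvature, compL_add, H.compL_d₁Mat hx, H.form_eq hx, H.form_eq hx,
    commutator_toL_add_toQ, compL_toL_add_toQ]

theorem GaugeField.compQ_K (H : GaugeField P) {i : ι} {x : M} (hx : x ∈ P.U i) (u v : Tan x) :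
    compQ (H.K i x u v) = d₁ (fun y w => H.θ i y w) x u v
      + (H.A i x u ⨯₃ H.θ i x v + H.θ i x u ⨯₃ H.A i x v) := by
  rw [GaugeField.K, curvature, compQ_add, H.compQ_d₁Mat hx, H.form_eq hx, H.form_eq hx,
    commutator_toL_add_toQ, compQ_toL_add_toQ]

theorem toSpin_add (a b : Fin 3 → ℝ) : toSpin (a + b) = toSpin a + toSpin b :=
  toSpinLinear.map_add a b

theorem toSpin_smul (c : ℝ) (a : Fin 3 → ℝ) : toSpin (c • a) = c • toSpin a :=
  toSpinLinear.map_smul c a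

/-- `e ∧ e` is dual to the cross product. -/
theorem CoframeBundle.ee_eq (C : CoframeBundle M ι) (i : ι) (x : M) (u v : Tan x) :
    C.ee i x u v = -toSpin (C.e i x u ⨯₃ C.e i x v) := by
  rw [toSpin_cross, neg_neg, CoframeBundle.ee]

section Coframe

variable [IsManifold 𝓘(ℝ, E3) ∞ M] (hP : IsSplit P) (H : GaugeField P)
  (hH : ∀ i, ∀ x ∈ P.U i, ∀ v, H.θ i x v = 0 → v = 0) {μ : ℝ} (hμ : μ ≠ 0)
  {i : ι} {x : M}

theorem coframe_spin (v : Tan x) :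
    (coframe hP H hH hμ).spin.form i x v = toSpin (H.A i x v) := rfl

theorem coframe_e (v : Tan x) : (coframe hP H hH hμ).e i x v = μ⁻¹ • H.θ i x v := rfl

theorem θ_eq (v : Tan x) : H.θ i x v = μ • (coframe hP H hH hμ).e i x v := by
  rw [coframe_e, smul_inv_smul₀ hμ]

theorem coframe_Ω (hx : x ∈ P.U i) (u v : Tan x) :
    (coframe hP H hH hμ).Ω i x u v
      = toSpin (d₁ (fun y w => H.A i y w) x u v + H.A i x u ⨯₃ H.A i x v) := by
  rw [toSpin_add, ← toSpin_commutator]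
  exact congrArg (· + (toSpin (H.A i x u) * toSpin (H.A i x v)
    - toSpin (H.A i x v) * toSpin (H.A i x u)))
    (d₁Mat_linear_comp toSpinLinear ((H.smooth_A i).diffAt hx) u v)

theorem coframe_T (hx : x ∈ P.U i) (u v : Tan x) :
    (coframe hP H hH hμ).T i x u v
      = μ⁻¹ • (d₁ (fun y w => H.θ i y w) x u v
        + (H.A i x u ⨯₃ H.θ i x v - H.A i x v ⨯₃ H.θ i x u)) := by
  have h : d₁ (fun y w => (coframe hP H hH hμ).e i y w) x u v
      = μ⁻¹ • d₁ (fun y w => H.θ i y w) x u v :=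
    d₁_linear_comp (μ⁻¹ • LinearMap.id) ((H.smooth_θ i).diffAt hx) u v
  rw [CoframeBundle.T, h, coframe_spin, coframe_spin, coframe_e, coframe_e, toSpin_mulVec,
    toSpin_mulVec, map_smul, map_smul, smul_add, smul_sub]

theorem toSpin_compL_K {Λ : ℝ} (hΛ : Λ ^ 2 = μ ^ 2) (hx : x ∈ P.U i) (u v : Tan x) :
    toSpin (compL (H.K i x u v))
      = (coframe hP H hH hμ).Ω i x u v - Λ ^ 2 • (coframe hP H hH hμ).ee i x u v := by
  rw [H.compL_K hx, coframe_Ω hP H hH hμ hx, CoframeBundle.ee_eq, coframe_e, coframe_e, hΛ,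
    ← add_assoc, toSpin_add, smul_neg, sub_neg_eq_add, ← toSpin_smul]
  congr 2
  simp only [map_smul, LinearMap.smul_apply, smul_smul]
  rw [show μ ^ 2 * (μ⁻¹ * μ⁻¹) = 1 by field_simp, one_smul]

theorem compQ_K_eq_T (hx : x ∈ P.U i) (u v : Tan x) :
    compQ (H.K i x u v) = μ • (coframe hP H hH hμ).T i x u v := by
  rw [H.compQ_K hx, coframe_T hP H hH hμ hx, smul_inv_smul₀ hμ, sub_eq_add_neg, cross_anticomm]

end Coframe

/-! ### The Lagrangian -/

theorem invTr_mul_left (a b : Fin 3 → ℝ) (Z : Matrix (Fin 2 ⊕ Fin 2) (Fin 2 ⊕ Fin 2) ℂ) :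
    invTr ((toL a + toQ b) * Z) = a ⬝ᵥ compQ Z + b ⬝ᵥ compL Z := by
  have hcomm : invTr ((toL a + toQ b) * Z) = invTr (Z * (toL a + toQ b)) := by
    rw [toL_add_toQ, ← Z.fromBlocks_toBlocks, Matrix.fromBlocks_multiply,
      Matrix.fromBlocks_multiply]
    simp only [invTr, Matrix.toBlocks_fromBlocks₂₂, Matrix.toBlocks_fromBlocks₁₁, mul_zero,
      zero_mul, add_zero, zero_add]
    rw [Matrix.trace_mul_comm, Matrix.trace_mul_comm Z.toBlocks₁₁]
  rw [hcomm, mul_add, invTr_add, toL, toQ]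
  simp only [Fin.sum_univ_three, mul_add, mul_smul_comm, invTr_add, invTr_smul, dotProduct, compQ,
    compL]

theorem GaugeField.chernSimons_eq (H : GaugeField P) {i : ι} {x : M} (hx : x ∈ P.U i)
    (u v w : Tan x) :
    H.chernSimons i x u v w =
      (H.A i x u ⬝ᵥ d₁ (fun y w => H.θ i y w) x v w + H.θ i x u ⬝ᵥ d₁ (fun y w => H.A i y w) x v w)
      + (H.A i x v ⬝ᵥ d₁ (fun y w => H.θ i y w) x w u
        + H.θ i x v ⬝ᵥ d₁ (fun y w => H.A i y w) x w u)
      + (H.A i x w ⬝ᵥ d₁ (fun y w => H.θ i y w) x u v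
        + H.θ i x w ⬝ᵥ d₁ (fun y w => H.A i y w) x u v)
      + 2 * (H.A i x u ⬝ᵥ (H.A i x v ⨯₃ H.θ i x w + H.θ i x v ⨯₃ H.A i x w)
        + H.θ i x u ⬝ᵥ (H.A i x v ⨯₃ H.A i x w + H.θ i x v ⨯₃ H.θ i x w)) := by
  have key : ∀ a b a' b' c d e f g h : Fin 3 → ℝ,
      invTr ((toL a + toQ b) * ((toL a' + toQ b') * (toL c + toQ d)
        - (toL c + toQ d) * (toL a' + toQ b')))
        = a ⬝ᵥ (a' ⨯₃ d + b' ⨯₃ c) + b ⬝ᵥ (a' ⨯₃ c + b' ⨯₃ d) := by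
    intros
    rw [commutator_toL_add_toQ, invTr_mul]
  simp only [GaugeField.chernSimons]
  rw [invTr_add, invTr_add, invTr_add, invTr_smul, invTr_add, invTr_add]
  rw [H.form_eq hx u, H.form_eq hx v, H.form_eq hx w]
  simp only [invTr_mul_left, commutator_toL_add_toQ, compL_toL_add_toQ, compQ_toL_add_toQ,
    H.compL_d₁Mat hx, H.compQ_d₁Mat hx]
  simp only [cross_apply, dotProduct, Fin.sum_univ_three, Pi.add_apply, Matrix.cons_val]
  ring

/-- `d (A_k ∧ θᵏ) = dA_k ∧ θᵏ - A_k ∧ dθᵏ`. -/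
theorem GaugeField.d₂_Aθ [IsManifold 𝓘(ℝ, E3) ∞ M] (H : GaugeField P) {i : ι} {x : M}
    (hx : x ∈ P.U i) (u v w : Tan x) :
    d₂ (H.Aθ i) x u v w =
      (d₁ (fun y w => H.A i y w) x u v ⬝ᵥ H.θ i x w - H.A i x w ⬝ᵥ d₁ (fun y w => H.θ i y w) x u v)
      + (d₁ (fun y w => H.A i y w) x v w ⬝ᵥ H.θ i x u
        - H.A i x u ⬝ᵥ d₁ (fun y w => H.θ i y w) x v w)
      + (d₁ (fun y w => H.A i y w) x w u ⬝ᵥ H.θ i x v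
        - H.A i x v ⬝ᵥ d₁ (fun y w => H.θ i y w) x w u) := by
  set y₀ := extChartAt 𝓘(ℝ, E3) x x with hy₀
  set a := coeff₁ (fun y w => H.A i y w) x with ha
  set t := coeff₁ (fun y w => H.θ i y w) x with ht
  have had : ∀ z, DifferentiableAt ℝ (a z) y₀ := (H.smooth_A i).diffAt hx
  have htd : ∀ z, DifferentiableAt ℝ (t z) y₀ := (H.smooth_θ i).diffAt hx
  have ha0 : ∀ z, a z y₀ = H.A i x z := coeff₁_self _ x
  have ht0 : ∀ z, t z y₀ = H.θ i x z := coeff₁_self _ x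
  have hD : ∀ p q z : E3, fderiv ℝ (coeff₂ (H.Aθ i) x p q) y₀ z
      = H.A i x p ⬝ᵥ fderiv ℝ (t q) y₀ z + fderiv ℝ (a p) y₀ z ⬝ᵥ H.θ i x q
        - (H.A i x q ⬝ᵥ fderiv ℝ (t p) y₀ z + fderiv ℝ (a q) y₀ z ⬝ᵥ H.θ i x p) := by
    intro p q z
    have h1 := fderiv_bilinear (dotProductBilin ℝ ℝ) (had p) (htd q) z
    have h2 := fderiv_bilinear (dotProductBilin ℝ ℝ) (had q) (htd p) z
    have h3 := differentiableAt_bilinear (dotProductBilin ℝ ℝ) (had p) (htd q)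
    have h4 := differentiableAt_bilinear (dotProductBilin ℝ ℝ) (had q) (htd p)
    have h5 : coeff₂ (H.Aθ i) x p q = fun y => dotProductBilin ℝ ℝ (a p y) (t q y)
      - dotProductBilin ℝ ℝ (a q y) (t p y) := rfl
    rw [h5, fderiv_fun_sub h3 h4]
    rw [← ha0, ← ha0, ← ht0, ← ht0]
    exact congrArg₂ (· - ·) h1 h2
  have hdA : ∀ p q : E3, d₁ (fun y w => H.A i y w) x p q
      = fderiv ℝ (a q) y₀ p - fderiv ℝ (a p) y₀ q := fun _ _ => rfl
  have hdθ : ∀ p q : E3, d₁ (fun y w => H.θ i y w) x p q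
      = fderiv ℝ (t q) y₀ p - fderiv ℝ (t p) y₀ q := fun _ _ => rfl
  have hd₂ : d₂ (H.Aθ i) x u v w = fderiv ℝ (coeff₂ (H.Aθ i) x v w) y₀ u
    + fderiv ℝ (coeff₂ (H.Aθ i) x w u) y₀ v + fderiv ℝ (coeff₂ (H.Aθ i) x u v) y₀ w := rfl
  refine hd₂.trans ((congrArg₂ (· + ·) (congrArg₂ (· + ·) (hD v w u) (hD w u v))
    (hD u v w)).trans ?_)
  refine Eq.trans ?_ (congrArg₂ (· + ·) (congrArg₂ (· + ·)
    (congrArg₂ (fun α β => α ⬝ᵥ H.θ i x w - H.A i x w ⬝ᵥ β) (hdA u v) (hdθ u v))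
    (congrArg₂ (fun α β => α ⬝ᵥ H.θ i x u - H.A i x u ⬝ᵥ β) (hdA v w) (hdθ v w)))
    (congrArg₂ (fun α β => α ⬝ᵥ H.θ i x v - H.A i x v ⬝ᵥ β) (hdA w u) (hdθ w u))).symm
  simp only [sub_dotProduct, dotProduct_sub]
  ring

theorem sum_eps_mul_toSpin (a b : Fin 3 → ℝ) :
    ∑ l, ∑ j, ∑ k, eps l j k * (a l * toSpin b j k) = -2 * (a ⬝ᵥ b) := by
  rw [sum_eps_mul, toSpin_eq]
  simp [dotProduct, Fin.sum_univ_three]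
  ring

theorem CoframeBundle.einsteinHilbert_eq_sum (C : CoframeBundle M ι) (Λ : ℝ) (i : ι) (x : M)
    (u v w : Tan x) :
    C.einsteinHilbert Λ i x u v w =
      ∑ l, ∑ j, ∑ k, eps l j k * (C.e i x u l * (C.Ω i x v w - (Λ ^ 2 / 3) • C.ee i x v w) j k)
      + ∑ l, ∑ j, ∑ k, eps l j k * (C.e i x v l * (C.Ω i x w u - (Λ ^ 2 / 3) • C.ee i x w u) j k)
      + ∑ l, ∑ j, ∑ k, eps l j k *
        (C.e i x w l * (C.Ω i x u v - (Λ ^ 2 / 3) • C.ee i x u v) j k) := by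
  simp only [CoframeBundle.einsteinHilbert, mul_add, Finset.sum_add_distrib]

section Coframe

variable [IsManifold 𝓘(ℝ, E3) ∞ M] (hP : IsSplit P) (H : GaugeField P)
  (hH : ∀ i, ∀ x ∈ P.U i, ∀ v, H.θ i x v = 0 → v = 0) {μ : ℝ} (hμ : μ ≠ 0)
  {i : ι} {x : M}

theorem coframe_einsteinHilbert {Λ : ℝ} (hΛ : Λ ^ 2 = μ ^ 2) (hx : x ∈ P.U i) (u v w : Tan x) :
    (coframe hP H hH hμ).einsteinHilbert Λ i x u v w = -2 * μ⁻¹ *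
      (H.θ i x u ⬝ᵥ (d₁ (fun y w => H.A i y w) x v w + H.A i x v ⨯₃ H.A i x w)
        + H.θ i x v ⬝ᵥ (d₁ (fun y w => H.A i y w) x w u + H.A i x w ⨯₃ H.A i x u)
        + H.θ i x w ⬝ᵥ (d₁ (fun y w => H.A i y w) x u v + H.A i x u ⨯₃ H.A i x v)
        + H.θ i x u ⬝ᵥ (H.θ i x v ⨯₃ H.θ i x w)) := by
  have hB : ∀ p q : Tan x, (coframe hP H hH hμ).Ω i x p q
      - (Λ ^ 2 / 3) • (coframe hP H hH hμ).ee i x p q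
      = toSpin (d₁ (fun y w => H.A i y w) x p q + H.A i x p ⨯₃ H.A i x q
        + (1 / 3 : ℝ) • (H.θ i x p ⨯₃ H.θ i x q)) := by
    intro p q
    rw [coframe_Ω hP H hH hμ hx, CoframeBundle.ee_eq, coframe_e, coframe_e, hΛ, smul_neg,
      sub_neg_eq_add, ← toSpin_smul, ← toSpin_add]
    simp only [map_smul, LinearMap.smul_apply, smul_smul]
    rw [show μ ^ 2 / 3 * (μ⁻¹ * μ⁻¹) = 1 / 3 by field_simp]
  rw [CoframeBundle.einsteinHilbert_eq_sum, hB, hB, hB, sum_eps_mul_toSpin, sum_eps_mul_toSpin,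
    sum_eps_mul_toSpin, coframe_e, coframe_e, coframe_e]
  simp only [smul_dotProduct, smul_eq_mul, dotProduct_add, dotProduct_smul]
  rw [← triple_product_permutation (H.θ i x v) (H.θ i x w) (H.θ i x u),
    ← triple_product_permutation (H.θ i x u) (H.θ i x v) (H.θ i x w)]
  ring

/-- The Chern–Simons Lagrangian is the Einstein–Hilbert Lagrangian up to `d (A_k ∧ θᵏ)`. -/
theorem chernSimons_eq_einsteinHilbert {m κ Λ Gₙ : ℝ} (hm : m ≠ 0) (hκ : κ ≠ 0)
    (hΛ : Λ ^ 2 = μ ^ 2) (hG : Gₙ = κ ^ 2 / (4 * m * μ)) (hx : x ∈ P.U i) (u v w : Tan x) :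
    m / (4 * Real.pi * κ ^ 2) * H.chernSimons i x u v w
      = -(1 / (16 * Real.pi * Gₙ)) * (coframe hP H hH hμ).einsteinHilbert Λ i x u v w
        - m / (4 * Real.pi * κ ^ 2) * d₂ (H.Aθ i) x u v w := by
  have hcoef : -(1 / (16 * Real.pi * Gₙ)) * (-2 * μ⁻¹) = m / (4 * Real.pi * κ ^ 2) * 2 := by
    have := Real.pi_ne_zero
    rw [hG]
    field_simp
    ring
  obtain ⟨S, hS, hCS⟩ : ∃ S, (coframe hP H hH hμ).einsteinHilbert Λ i x u v w = -2 * μ⁻¹ * S ∧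
      H.chernSimons i x u v w = 2 * S - d₂ (H.Aθ i) x u v w := by
    refine ⟨_, coframe_einsteinHilbert hP H hH hμ hΛ hx u v w, ?_⟩
    rw [H.chernSimons_eq hx, H.d₂_Aθ hx]
    simp only [cross_apply, dotProduct, Fin.sum_univ_three, Pi.add_apply, Matrix.cons_val]
    ring
  rw [hS, hCS]
  linear_combination (-S) * hcoef

/-- The Einstein–Hilbert Lagrangian does not depend on the trivialization. -/
theorem CoframeBundle.einsteinHilbert_glue (C : CoframeBundle M ι) (Λ : ℝ) {i j : ι} {x : M}
    (hx : x ∈ C.U i ∩ C.U j) (u v w : Tan x) :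
    C.einsteinHilbert Λ i x u v w = C.einsteinHilbert Λ j x u v w := by
  set O : Matrix (Fin 3) (Fin 3) ℝ := so3Rep (C.t i j x)⁻¹ with hO
  have hdet : O.det = 1 := ((C.t i j x)⁻¹ : SO3).2.2
  have hOt : so3Rep (C.t i j x) = Oᵀ := by
    have h := so3_coe_inv (C.t i j x)⁻¹
    rw [inv_inv] at h
    exact h
  have he : ∀ z, C.e j x z = O *ᵥ C.e i x z := fun z => C.glue_e i j x hx z
  have hee : ∀ p q, C.ee j x p q = O * C.ee i x p q * Oᵀ := by
    intro p q
    have h : ∀ k, C.ee k x p q = Matrix.vecMulVec (C.e k x p) (C.e k x q)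
        - Matrix.vecMulVec (C.e k x q) (C.e k x p) := by
      intro k
      ext a b
      simp [CoframeBundle.ee, Matrix.vecMulVec_apply]
    rw [h, h, he, he, mul_sub, sub_mul, Matrix.mul_vecMulVec, Matrix.mul_vecMulVec,
      Matrix.vecMulVec_mul, Matrix.vecMulVec_mul, Matrix.vecMul_transpose, Matrix.vecMul_transpose]
  have hΩ : ∀ p q, C.Ω j x p q = O * C.Ω i x p q * Oᵀ := by
    intro p q
    rw [← hOt]
    exact C.spin.curvature_glue hx p q
  have hB : ∀ p q, C.Ω j x p q - (Λ ^ 2 / 3) • C.ee j x p q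
      = O * (C.Ω i x p q - (Λ ^ 2 / 3) • C.ee i x p q) * Oᵀ := by
    intro p q
    rw [hΩ, hee, mul_sub, sub_mul, mul_smul_comm, smul_mul_assoc]
  rw [C.einsteinHilbert_eq_sum, C.einsteinHilbert_eq_sum, hB, hB, hB, he, he, he,
    sum_eps_mul_conj O hdet, sum_eps_mul_conj O hdet, sum_eps_mul_conj O hdet]

/-! ### Local isometries -/

omit [IsManifold 𝓘(ℝ, E3) ∞ M] in
theorem gaugeVar_toL (hx : x ∈ P.U i) {α : M → Fin 3 → ℝ}
    (hα : MDifferentiableAt 𝓘(ℝ, E3) 𝓘(ℝ, Fin 3 → ℝ) α x) (v : Tan x) :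
    gaugeVar (fun y w => H.form i y w) (fun y => toL (α y)) x v
      = toL (d₀ α x v + H.A i x v ⨯₃ α x) + toQ (H.θ i x v ⨯₃ α x) := by
  have hd : d₀Mat (fun y => toL (α y)) x v = toL (d₀ α x v) := d₀Mat_linear_comp toLLinear hα v
  have h0 : toL (α x) = toL (α x) + toQ 0 := by simp [toQ]
  have hadd : ∀ a b, toL (a + b) = toL a + toL b := toLLinear.map_add
  rw [gaugeVar, hd, h0, H.form_eq hx, commutator_toL_add_toQ]
  simp only [map_zero, add_zero, zero_add]
  rw [hadd, add_assoc]

omit [IsManifold 𝓘(ℝ, E3) ∞ M] in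
theorem gaugeVar_toQ (hx : x ∈ P.U i) {ζ : M → Fin 3 → ℝ}
    (hζ : MDifferentiableAt 𝓘(ℝ, E3) 𝓘(ℝ, Fin 3 → ℝ) ζ x) (v : Tan x) :
    gaugeVar (fun y w => H.form i y w) (fun y => toQ (ζ y)) x v
      = toL (H.θ i x v ⨯₃ ζ x) + toQ (d₀ ζ x v + H.A i x v ⨯₃ ζ x) := by
  have hd : d₀Mat (fun y => toQ (ζ y)) x v = toQ (d₀ ζ x v) := d₀Mat_linear_comp toQLinear hζ v
  have h0 : toQ (ζ x) = toL 0 + toQ (ζ x) := by simp [toL]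
  have hadd : ∀ a b, toQ (a + b) = toQ a + toQ b := toQLinear.map_add
  rw [gaugeVar, hd, h0, H.form_eq hx, commutator_toL_add_toQ]
  simp only [map_zero, add_zero, zero_add]
  rw [hadd]
  abel

theorem gaugeVar_spin {α : M → Fin 3 → ℝ}
    (hα : MDifferentiableAt 𝓘(ℝ, E3) 𝓘(ℝ, Fin 3 → ℝ) α x) (v : Tan x) :
    gaugeVar (fun y w => (coframe hP H hH hμ).spin.form i y w) (fun y => toSpin (α y)) x v
      = toSpin (d₀ α x v + H.A i x v ⨯₃ α x) := by
  rw [toSpin_add, ← toSpin_commutator, gaugeVar]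
  exact congrArg₂ (· + ·) (d₀Mat_linear_comp toSpinLinear hα v) rfl

/-! ### The Lie derivative and pseudo-translations -/

/-- On the spin connection, the Lie derivative differs from the pseudo-translation by
`i_X (Ω - Λ² e e)`, up to the local isometry `i_X ω`. -/
theorem lieDeriv_spin_sub {Λ : ℝ} (hΛ : Λ ^ 2 = μ ^ 2) (hx : x ∈ P.U i)
    {X : ∀ x : M, Tan x} (hX : ContDiffAt ℝ 1 (coordField X x) (extChartAt 𝓘(ℝ, E3) x x))
    {ζ : M → Fin 3 → ℝ} (hζ : ∀ y ∈ P.U i, ζ y = H.θ i y (X y)) (v : Tan x) :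
    lieDerivMat X (fun y w => (coframe hP H hH hμ).spin.form i y w) x v
        - toSpin (compL (gaugeVar (fun y w => H.form i y w) (fun y => toQ (ζ y)) x v))
        - gaugeVar (fun y w => (coframe hP H hH hμ).spin.form i y w)
          (fun y => (coframe hP H hH hμ).spin.form i y (X y)) x v
      = (coframe hP H hH hμ).Ω i x (X x) v - Λ ^ 2 • (coframe hP H hH hμ).ee i x (X x) v := by
  have hA : ∀ w, ContDiffAt ℝ 1 (coeff₁ (fun y w => H.A i y w) x w) (extChartAt 𝓘(ℝ, E3) x x) :=
    fun w => (H.smooth_A i x hx w).of_le (by norm_cast)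
  have hθ : ∀ w, ContDiffAt ℝ 1 (coeff₁ (fun y w => H.θ i y w) x w) (extChartAt 𝓘(ℝ, E3) x x) :=
    fun w => (H.smooth_θ i x hx w).of_le (by norm_cast)
  have hAX := (contMDiffAt_contraction (β := fun y => compLLinear ∘ₗ H.form i y) hA
    hX).mdifferentiableAt one_ne_zero
  have hθX := (contMDiffAt_contraction (β := fun y => compQLinear ∘ₗ H.form i y) hθ
    hX).mdifferentiableAt one_ne_zero
  have hζd : MDifferentiableAt 𝓘(ℝ, E3) 𝓘(ℝ, Fin 3 → ℝ) ζ x :=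
    hθX.congr_of_eventuallyEq (((P.isOpen_U i).mem_nhds hx |> Filter.eventually_of_mem) hζ)
  have hlie : lieDerivMat X (fun y w => (coframe hP H hH hμ).spin.form i y w) x v
      = toSpin (d₁ (fun y w => H.A i y w) x (X x) v + d₀ (fun y => H.A i y (X y)) x v) :=
    (lieDerivMat_linear_comp toSpinLinear X ((H.smooth_A i).diffAt hx) v).trans
      (congrArg toSpin (lieDeriv_eq (β := fun y => compLLinear ∘ₗ H.form i y) hA hX v))
  have hgs : gaugeVar (fun y w => (coframe hP H hH hμ).spin.form i y w)
      (fun y => (coframe hP H hH hμ).spin.form i y (X y)) x v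
      = toSpin (d₀ (fun y => H.A i y (X y)) x v + H.A i x v ⨯₃ H.A i x (X x)) :=
    gaugeVar_spin hP H hH hμ hAX v
  rw [hlie, hgs, gaugeVar_toQ H hx hζd, compL_toL_add_toQ, ← toSpin_compL_K hP H hH hμ hΛ hx,
    H.compL_K hx, hζ x hx, ← cross_anticomm (H.A i x v), ← cross_anticomm (H.θ i x v)]
  have hneg : ∀ a, toSpin (-a) = -toSpin a := toSpinLinear.map_neg
  simp only [toSpin_add, hneg]
  abel

/-- On the dreibein, the Lie derivative differs from the pseudo-translation by `i_X T`, up to the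
local isometry `i_X ω`. -/
theorem lieDeriv_e_sub (hx : x ∈ P.U i)
    {X : ∀ x : M, Tan x} (hX : ContDiffAt ℝ 1 (coordField X x) (extChartAt 𝓘(ℝ, E3) x x))
    {ζ : M → Fin 3 → ℝ} (hζ : ∀ y ∈ P.U i, ζ y = H.θ i y (X y)) (v : Tan x) :
    lieDeriv X (fun y w => (coframe hP H hH hμ).e i y w) x v
        - μ⁻¹ • compQ (gaugeVar (fun y w => H.form i y w) (fun y => toQ (ζ y)) x v)
        - -((coframe hP H hH hμ).spin.form i x (X x) *ᵥ (coframe hP H hH hμ).e i x v)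
      = (coframe hP H hH hμ).T i x (X x) v := by
  have hθ : ∀ w, ContDiffAt ℝ 1 (coeff₁ (fun y w => H.θ i y w) x w) (extChartAt 𝓘(ℝ, E3) x x) :=
    fun w => (H.smooth_θ i x hx w).of_le (by norm_cast)
  have hθX := (contMDiffAt_contraction (β := fun y => compQLinear ∘ₗ H.form i y) hθ
    hX).mdifferentiableAt one_ne_zero
  have hev : ζ =ᶠ[𝓝 x] fun y => H.θ i y (X y) :=
    ((P.isOpen_U i).mem_nhds hx |> Filter.eventually_of_mem) hζ
  have hζd : MDifferentiableAt 𝓘(ℝ, E3) 𝓘(ℝ, Fin 3 → ℝ) ζ x := hθX.congr_of_eventuallyEq hev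
  have hd : d₀ ζ x v = d₀ (fun y => H.θ i y (X y)) x v := DFunLike.congr_fun hev.mfderiv_eq v
  have hlie : lieDeriv X (fun y w => (coframe hP H hH hμ).e i y w) x v
      = μ⁻¹ • (d₁ (fun y w => H.θ i y w) x (X x) v + d₀ (fun y => H.θ i y (X y)) x v) :=
    (lieDeriv_linear_comp (μ⁻¹ • LinearMap.id) X ((H.smooth_θ i).diffAt hx) v).trans
      (congrArg (μ⁻¹ • ·) (lieDeriv_eq (β := fun y => compQLinear ∘ₗ H.form i y) hθ hX v))
  rw [hlie, gaugeVar_toQ H hx hζd, compQ_toL_add_toQ, coframe_T hP H hH hμ hx, coframe_spin,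
    coframe_e, toSpin_mulVec, map_smul, hd, hζ x hx]
  module

end Coframe

end FieldStrength

/-! ### The bundle map -/

section BundleMap

open Filter Topology

variable {M : Type*} [TopologicalSpace M] [ChartedSpace E3 M] [IsManifold 𝓘(ℝ, E3) ∞ M]
  {ι : Type*} {P : GaugeBundle M ι}

/-- The bundle map from the gauge bundle to the `SO(3)`-bundle, `(x, (a, b)) ↦ (x, Γ₁ b)` in
every trivialization. -/
def bundleMap (P : GaugeBundle M ι) (p : P.Total) : (so3Bundle P).Total :=
  ⟨p.1, su2ToSO3 (show SU2 × SU2 from p.2).2⟩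

theorem coord_bundleMap (i : ι) (p : P.Total) :
    (so3Bundle P).coord i (bundleMap P p) = su2ToSO3 (P.coord i p).2 :=
  (map_mul su2ToSO3 _ _).symm

theorem bundleMap_act (p : P.Total) (s : SU2) :
    bundleMap P (P.act p (s, s)) = (so3Bundle P).act (bundleMap P p) (su2ToSO3 s) :=
  congrArg (Bundle.TotalSpace.mk p.1) (map_mul su2ToSO3 _ _)

theorem continuous_bundleMap : Continuous (bundleMap P) := by
  refine continuous_iff_continuousAt.2 fun p => ?_
  refine (FiberBundle.continuousAt_totalSpace _ _).2
    ⟨(P.core.continuous_proj).continuousAt, ?_⟩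
  have h : ContinuousAt (fun q : P.Total => P.coord (P.indexAt p.1) q) p := by
    refine continuous_snd.continuousAt.comp ?_
    refine (P.core.localTriv (P.indexAt p.1)).continuousAt ?_
    rw [FiberBundleCore.mem_localTriv_source]
    exact P.mem_indexAt p.1
  have h2 : ContinuousAt (fun q : P.Total => su2ToSO3 (P.coord (P.indexAt p.1) q).2) p :=
    continuous_su2ToSO3.continuousAt.comp (continuous_snd.continuousAt.comp h)
  exact h2.congr (Eventually.of_forall fun q => (coord_bundleMap (P.indexAt p.1) q).symm)

end BundleMap

/-! ### Pseudo-translations as vector fields -/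

section PseudoTranslations

open Filter Topology

variable {M : Type*} [TopologicalSpace M] [ChartedSpace E3 M] [IsManifold 𝓘(ℝ, E3) ∞ M]
  {ι : Type*} {P : GaugeBundle M ι}

omit [IsManifold 𝓘(ℝ, E3) ∞ M] in
theorem toQ_conj (s : SU2) (a : Fin 3 → ℝ) :
    gaugeRep (s, s)⁻¹ * toQ a * gaugeRep (s, s)
      = toQ (adForm (s⁻¹ : SU2) (s⁻¹ : SU2) *ᵥ a) := by
  have hinv : gaugeRep (s, s)⁻¹ = Matrix.fromBlocks ((s⁻¹ : SU2) : Matrix (Fin 2) (Fin 2) ℂ) 0 0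
      ((s⁻¹ : SU2) : Matrix (Fin 2) (Fin 2) ℂ) := rfl
  have hrep : gaugeRep (s, s) = Matrix.fromBlocks (s : Matrix (Fin 2) (Fin 2) ℂ) 0 0
      (s : Matrix (Fin 2) (Fin 2) ℂ) := rfl
  rw [hinv, hrep, toQ_eq, toQ_eq, Matrix.fromBlocks_multiply, Matrix.fromBlocks_multiply]
  simp only [mul_zero, zero_mul, add_zero, zero_add, mul_neg, neg_mul, neg_zero,
    su2_conj_inv_toTau]

theorem toQ_injective : Function.Injective toQ := fun a b h => by
  have ha := compQ_toL_add_toQ 0 a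
  rw [h, compQ_toL_add_toQ] at ha
  exact ha.symm

omit [IsManifold 𝓘(ℝ, E3) ∞ M] in
/-- The vector-valued form of the gluing condition for pseudo-translation parameters. -/
theorem pseudo_glue_iff (hP : IsSplit P) {i j : ι} {x : M} (hx : x ∈ P.U i ∩ P.U j)
    (a b : Fin 3 → ℝ) :
    toQ b = gaugeRep (P.t i j x)⁻¹ * toQ a * gaugeRep (P.t i j x) ↔
      b = adForm ((P.t i j x).2⁻¹ : SU2) ((P.t i j x).2⁻¹ : SU2) *ᵥ a := by
  have ht : P.t i j x = ((P.t i j x).2, (P.t i j x).2) := Prod.ext (hP i j x hx) rfl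
  rw [ht, toQ_conj, toQ_injective.eq_iff]

omit [IsManifold 𝓘(ℝ, E3) ∞ M] in
theorem bijective_θ (H : GaugeField P)
    (hH : ∀ i, ∀ x ∈ P.U i, ∀ v, H.θ i x v = 0 → v = 0) {i : ι} {x : M} (hx : x ∈ P.U i) :
    Function.Bijective (compQLinear ∘ₗ H.form i x) := by
  have hinj : Function.Injective (compQLinear ∘ₗ H.form i x) :=
    (injective_iff_map_eq_zero _).2 fun v hv => hH i x hx v hv
  refine ⟨hinj, (LinearMap.injective_iff_surjective_of_finrank_eq_finrank ?_).1 hinj⟩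
  rw [finrank_tan]
  simp

open Classical in
/-- The pseudo-translation `ζ = θ(X)` defined by a vector field. -/
def pseudoOfVectorField (hP : IsSplit P) (H : GaugeField P) :
    SmoothVectorField M →ₗ[ℝ] pseudoTranslations P where
  toFun X := ⟨fun i x => if x ∈ P.U i then H.θ i x (X x) else 0, by
    refine ⟨fun i x hx => if_neg hx, fun i x hx => ?_, fun i j x hx => ?_⟩
    · have h := contMDiffAt_contraction (n := ∞) (β := fun y => compQLinear ∘ₗ H.form i y)
        (H.smooth_θ i x hx) (contDiffAt_coordField X x)
      refine (h.congr_of_eventuallyEq ?_).contMDiffWithinAt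
      filter_upwards [(P.isOpen_U i).mem_nhds hx] with y hy
      exact if_pos hy
    · beta_reduce
      rw [if_pos hx.1, if_pos hx.2, pseudo_glue_iff hP hx]
      obtain ⟨ξ, -, -, hθ⟩ := H.glue_components hP hx (X x)
      exact hθ⟩
  map_add' X Y := by
    refine Subtype.ext (funext fun i => funext fun x => ?_)
    change (if x ∈ P.U i then H.θ i x (X x + Y x) else 0)
      = (if x ∈ P.U i then H.θ i x (X x) else 0) + if x ∈ P.U i then H.θ i x (Y x) else 0
    split_ifs
    · exact (compQLinear ∘ₗ H.form i x).map_add (X x) (Y x)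
    · exact (add_zero 0).symm
  map_smul' c X := by
    refine Subtype.ext (funext fun i => funext fun x => ?_)
    change (if x ∈ P.U i then H.θ i x (c • X x) else 0)
      = c • if x ∈ P.U i then H.θ i x (X x) else 0
    split_ifs
    · exact (compQLinear ∘ₗ H.form i x).map_smul c (X x)
    · exact (smul_zero c).symm

theorem pseudoOfVectorField_apply (hP : IsSplit P) (H : GaugeField P) (X : SmoothVectorField M)
    {i : ι} {x : M} (hx : x ∈ P.U i) :
    (pseudoOfVectorField hP H X : ι → M → Fin 3 → ℝ) i x = H.θ i x (X x) :=
  if_pos hx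

/-- The coefficient maps of a 1-form in a chart, as a family of continuous linear maps. -/
def coeffMap (β : ∀ x : M, Tan x →ₗ[ℝ] (Fin 3 → ℝ)) (x : M) (y : E3) : E3 →L[ℝ] (Fin 3 → ℝ) :=
  ∑ a, (EuclideanSpace.proj (𝕜 := ℝ) a).smulRight
    (coeff₁ (fun z v => β z v) x (EuclideanSpace.basisFun (Fin 3) ℝ a) y)

omit [IsManifold 𝓘(ℝ, E3) ∞ M] in
theorem coeffMap_apply (β : ∀ x : M, Tan x →ₗ[ℝ] (Fin 3 → ℝ)) (x : M) (y w : E3) :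
    coeffMap β x y w = coeff₁ (fun z v => β z v) x w y := by
  rw [coeff₁_sum, coeffMap, sum_apply]
  rfl

/-- A vector field whose contraction with a smooth coframe is smooth is itself smooth, since
inversion of linear maps is smooth. -/
theorem contDiffAt_coordField_of_contraction {β : ∀ x : M, Tan x →ₗ[ℝ] (Fin 3 → ℝ)}
    {X : ∀ x : M, Tan x} {x : M} {U : Set M} (hU : IsOpen U) (hx : x ∈ U)
    (hβ : SmoothOneFormOn (fun z v => β z v) U) (hbij : ∀ y ∈ U, Function.Bijective (β y))
    (hX : ContMDiffAt 𝓘(ℝ, E3) 𝓘(ℝ, Fin 3 → ℝ) ∞ (fun z => β z (X z)) x) :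
    ContDiffAt ℝ ∞ (coordField X x) (extChartAt 𝓘(ℝ, E3) x x) := by
  set y₀ := extChartAt 𝓘(ℝ, E3) x x with hy₀
  have hE : ContDiffAt ℝ ∞ (coeffMap β x) y₀ := by
    refine ContDiffAt.sum fun a _ => ?_
    exact contDiffAt_const.smulRight (hβ x hx _)
  have hequiv : ∀ᶠ y in 𝓝 y₀, ∃ e : E3 ≃L[ℝ] (Fin 3 → ℝ), (e : E3 →L[ℝ] (Fin 3 → ℝ))
      = coeffMap β x y := by
    filter_upwards [eventually_mem_target x, eventually_mem_of_isOpen hU hx] with y hy hyU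
    have hb : Function.Bijective (coeffMap β x y) := by
      have hinj : Function.Injective (coeffMap β x y) := by
        refine (injective_iff_map_eq_zero _).2 fun w hw => ?_
        rw [coeffMap_apply] at hw
        have h0 := (injective_iff_map_eq_zero (β ((extChartAt 𝓘(ℝ, E3) x).symm y))).1
          (hbij _ hyU).1 _ hw
        rw [← mfderiv_coordVec hy w, h0]
        exact map_zero (mfderiv 𝓘(ℝ, E3) 𝓘(ℝ, E3) (extChartAt 𝓘(ℝ, E3) x)
          ((extChartAt 𝓘(ℝ, E3) x).symm y))
      exact ⟨hinj, (LinearMap.injective_iff_surjective_of_finrank_eq_finrank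
        (f := (coeffMap β x y).toLinearMap) (by simp)).1 hinj⟩
    exact ⟨(LinearEquiv.ofBijective (coeffMap β x y).toLinearMap hb).toContinuousLinearEquiv,
      ContinuousLinearMap.ext fun w => rfl⟩
  obtain ⟨e₀, he₀⟩ := hequiv.self_of_nhds
  have hinv : ContDiffAt ℝ ∞ (fun y => (coeffMap β x y).inverse) y₀ := by
    have h := contDiffAt_map_inverse (n := ∞) e₀
    rw [he₀] at h
    exact h.comp y₀ hE
  refine (hinv.clm_apply (contMDiffAt_iff_chart.1 hX)).congr_of_eventuallyEq ?_
  filter_upwards [hequiv, contraction_eventuallyEq β X x] with y hy hXy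
  obtain ⟨e, he⟩ := hy
  rw [hXy, ← coeff₁_sum, ← coeffMap_apply, ← he, ContinuousLinearMap.inverse_equiv]
  exact (e.symm_apply_apply _).symm

theorem bijective_pseudoOfVectorField (hP : IsSplit P) (H : GaugeField P)
    (hH : ∀ i, ∀ x ∈ P.U i, ∀ v, H.θ i x v = 0 → v = 0) :
    Function.Bijective (pseudoOfVectorField hP H) := by
  constructor
  · refine (injective_iff_map_eq_zero _).2 fun X hX => ContMDiffSection.ext fun x => ?_
    have hx := P.mem_indexAt x
    refine hH _ x hx _ ?_
    rw [← pseudoOfVectorField_apply hP H X hx, hX]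
    rfl
  · rintro ⟨ζ, hζ0, hζs, hζg⟩
    set X : ∀ x : M, Tan x := fun x =>
      (LinearEquiv.ofBijective _ (bijective_θ H hH (P.mem_indexAt x))).symm (ζ (P.indexAt x) x)
      with hXdef
    have hXi : ∀ i, ∀ x ∈ P.U i, H.θ i x (X x) = ζ i x := by
      intro i x hx
      have hx' : x ∈ P.U (P.indexAt x) ∩ P.U i := ⟨P.mem_indexAt x, hx⟩
      obtain ⟨ξ, -, -, hθ⟩ := H.glue_components hP hx' (X x)
      have h0 : H.θ (P.indexAt x) x (X x) = ζ (P.indexAt x) x :=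
        (LinearEquiv.ofBijective _ (bijective_θ H hH (P.mem_indexAt x))).apply_symm_apply _
      rw [hθ, h0, (pseudo_glue_iff hP hx' _ _).1 (hζg _ _ x hx')]
    have hsmooth : ∀ x, ContDiffAt ℝ ∞ (coordField X x) (extChartAt 𝓘(ℝ, E3) x x) := by
      intro x
      have hU := P.isOpen_U (P.indexAt x)
      have hx := P.mem_indexAt x
      refine contDiffAt_coordField_of_contraction
        (β := fun y => compQLinear ∘ₗ H.form (P.indexAt x) y) hU hx (H.smooth_θ _)
        (fun y hy => bijective_θ H hH hy) ?_
      refine ((hζs (P.indexAt x)).contMDiffAt (hU.mem_nhds hx)).congr_of_eventuallyEq ?_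
      filter_upwards [hU.mem_nhds hx] with y hy
      exact hXi _ y hy
    refine ⟨⟨X, (contMDiff_section_iff X).2 hsmooth⟩,
      Subtype.ext (funext fun i => funext fun x => ?_)⟩
    by_cases hx : x ∈ P.U i
    · rw [pseudoOfVectorField_apply hP H _ hx]
      exact hXi i x hx
    · exact (if_neg hx).trans (hζ0 i x hx).symm

end PseudoTranslations

/-! ### The metric -/

section Metric

variable {M : Type*} [TopologicalSpace M] [ChartedSpace E3 M] {ι : Type*}

theorem CoframeBundle.metric_eq (C : CoframeBundle M ι) {i : ι} {x : M} (hx : x ∈ C.U i)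
    (u v : Tan x) : C.metric x u v = C.e i x u ⬝ᵥ C.e i x v := by
  have hO := (Matrix.mem_orthogonalGroup_iff'
    (A := so3Rep (C.t i (C.indexAt x) x)⁻¹)).1 ((C.t i (C.indexAt x) x)⁻¹ : SO3).2.1
  rw [CoframeBundle.metric, C.glue_e i _ x ⟨hx, C.mem_indexAt x⟩,
    C.glue_e i _ x ⟨hx, C.mem_indexAt x⟩, Matrix.dotProduct_mulVec, Matrix.vecMul_mulVec,
    hO, Matrix.vecMul_one]

theorem CoframeBundle.metric_pos (C : CoframeBundle M ι) {x : M} {u : Tan x} (hu : u ≠ 0) :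
    0 < C.metric x u u := by
  change 0 < C.e (C.indexAt x) x u ⬝ᵥ C.e (C.indexAt x) x u
  refine lt_of_le_of_ne (Finset.sum_nonneg fun k _ => mul_self_nonneg _) fun h => hu ?_
  have h0 : C.e (C.indexAt x) x u = 0 := dotProduct_self_eq_zero.1 h.symm
  exact (injective_iff_map_eq_zero _).1 (C.bijective_e _ x (C.mem_indexAt x)).1 u h0

end Metric

end GaugeGravity

end

theorem mainTheorem2 {M : Type*} [TopologicalSpace M] [T2Space M] [ParacompactSpace M]
    [ChartedSpace GaugeGravity.E3 M] [IsManifold 𝓘(ℝ, GaugeGravity.E3) ∞ M] {ι : Type*}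
    (P : GaugeGravity.GaugeBundle M ι) (hP : GaugeGravity.IsSplit P)
    (H : GaugeGravity.GaugeField P)
    (hH : ∀ i, ∀ x ∈ P.U i, ∀ v, H.θ i x v = 0 → v = 0)
    (m κ μ Λ Gₙ : ℝ) (hm : m ≠ 0) (hκ : κ ≠ 0) (hμ : μ ≠ 0)
    (hΛ : Λ ^ 2 = μ ^ 2) (hG : Gₙ = κ ^ 2 / (4 * m * μ)) :
    ∃ (Γ₁ : GaugeGravity.SU2 →* GaugeGravity.SO3)
      (Γ₂ : GaugeGravity.pseudoTranslations P ≃ₗ[ℝ] GaugeGravity.SmoothVectorField M)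
      (Γ₃ : M ≃ₘ⟮𝓘(ℝ, GaugeGravity.E3), 𝓘(ℝ, GaugeGravity.E3)⟯ M)
      (C : GaugeGravity.CoframeBundle M ι)
      (f : P.Total → C.toPrincipalBundle.Total),
      -- `Γ₁` is the surjection of `SU(2)` onto `SO(3)` given by the adjoint action
      Function.Surjective Γ₁ ∧
      (∀ (s : GaugeGravity.SU2) (j : Fin 3),
        (s : Matrix (Fin 2) (Fin 2) ℂ) * GaugeGravity.tau j
            * ((s⁻¹ : GaugeGravity.SU2) : Matrix (Fin 2) (Fin 2) ℂ)
          = ∑ i, (Γ₁ s : Matrix (Fin 3) (Fin 3) ℝ) i j • GaugeGravity.tau i) ∧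
      -- the coframe bundle has the cover of `P`, and the transition functions of its
      -- `SU(2)`-subbundle transported by `Γ₁`
      C.U = P.U ∧ C.indexAt = P.indexAt ∧
      (∀ i j, ∀ x ∈ P.U i ∩ P.U j, C.t i j x = Γ₁ (P.t i j x).2) ∧
      -- `Γ₃`: the base is the same manifold, with the metric defined by the dreibein
      (∀ x, Γ₃ x = x) ∧
      (∀ i, ∀ x ∈ C.U i, ∀ u v, C.metric x u v = C.e i x u ⬝ᵥ C.e i x v) ∧
      (∀ x u, u ≠ 0 → 0 < C.metric x u u) ∧
      -- `f` is a continuous bundle map over `Γ₃`, equivariant along `Γ₁` for the action of the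
      -- stability group, and smooth; in the trivializations
      -- `(a, b) = (a b⁻¹, 1) * (b, b)` goes to `Γ₁ b`
      Continuous f ∧
      (∀ p, (f p).proj = Γ₃ p.proj) ∧
      (∀ p (s : GaugeGravity.SU2), f (P.act p (s, s)) = C.act (f p) (Γ₁ s)) ∧
      (∀ i p, p.proj ∈ P.U i → C.coord i (f p) = Γ₁ (P.coord i p).2) ∧
      -- `Γ₄`: `A ↦ ω`, `θ ↦ μ e`
      (∀ i, ∀ x ∈ P.U i, ∀ v,
        C.spin.form i x v = GaugeGravity.toSpin (H.A i x v) ∧ H.θ i x v = μ • C.e i x v) ∧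
      -- the field strength becomes `Ω - Λ² e e` and the torsion
      (∀ i, ∀ x ∈ P.U i, ∀ u v,
        GaugeGravity.toSpin (GaugeGravity.compL (H.K i x u v))
            = C.Ω i x u v - Λ ^ 2 • C.ee i x u v ∧
          GaugeGravity.compQ (H.K i x u v) = μ • C.T i x u v) ∧
      -- the Chern-Simons Lagrangian becomes the Einstein-Hilbert Lagrangian with cosmological
      -- constant, up to an exact form; the latter is globally defined
      (∀ i, ∀ x ∈ P.U i, ∀ u v w,
        m / (4 * Real.pi * κ ^ 2) * H.chernSimons i x u v w
          = -(1 / (16 * Real.pi * Gₙ)) * C.einsteinHilbert Λ i x u v w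
            - m / (4 * Real.pi * κ ^ 2) * GaugeGravity.d₂ (H.Aθ i) x u v w) ∧
      (∀ i j, ∀ x ∈ C.U i ∩ C.U j, ∀ u v w,
        C.einsteinHilbert Λ i x u v w = C.einsteinHilbert Λ j x u v w) ∧
      -- gauge transformations of the stability group become local isometries
      (∀ i, ∀ α : M → Fin 3 → ℝ,
        ContMDiffOn 𝓘(ℝ, GaugeGravity.E3) 𝓘(ℝ, Fin 3 → ℝ) ∞ α (P.U i) →
        ∀ x ∈ P.U i, ∀ v,
          GaugeGravity.toSpin (GaugeGravity.compL (GaugeGravity.gaugeVar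
              (fun y w => H.form i y w) (fun y => GaugeGravity.toL (α y)) x v))
            = GaugeGravity.gaugeVar (fun y w => C.spin.form i y w)
                (fun y => GaugeGravity.toSpin (α y)) x v ∧
          GaugeGravity.compQ (GaugeGravity.gaugeVar
              (fun y w => H.form i y w) (fun y => GaugeGravity.toL (α y)) x v)
            = μ • (-(GaugeGravity.toSpin (α x) *ᵥ C.e i x v))) ∧
      -- `Γ₂`: pseudo-translations correspond to vector fields through `ζ = μ i_X e`, and `ζ` acts
      -- as the Lie derivative along `X`, up to the local isometry with parameter `i_X ω`,
      -- exactly when `X` is a restricted diffeomorphism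
      (∀ ζ : GaugeGravity.pseudoTranslations P, ∀ i, ∀ x ∈ P.U i,
        (ζ : ι → M → Fin 3 → ℝ) i x = μ • C.e i x (Γ₂ ζ x)) ∧
      (∀ ζ : GaugeGravity.pseudoTranslations P, Γ₂ ζ ∈ C.restrictedDiff Λ ↔
        ∀ i, ∀ x ∈ P.U i, ∀ v,
          GaugeGravity.lieDerivMat (Γ₂ ζ) (fun y w => C.spin.form i y w) x v
              - GaugeGravity.toSpin (GaugeGravity.compL (GaugeGravity.gaugeVar
                  (fun y w => H.form i y w)
                  (fun y => GaugeGravity.toQ ((ζ : ι → M → Fin 3 → ℝ) i y)) x v))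
            = GaugeGravity.gaugeVar (fun y w => C.spin.form i y w)
                (fun y => C.spin.form i y (Γ₂ ζ y)) x v ∧
          GaugeGravity.lieDeriv (Γ₂ ζ) (fun y w => C.e i y w) x v
              - μ⁻¹ • GaugeGravity.compQ (GaugeGravity.gaugeVar
                  (fun y w => H.form i y w)
                  (fun y => GaugeGravity.toQ ((ζ : ι → M → Fin 3 → ℝ) i y)) x v)
            = -(C.spin.form i x (Γ₂ ζ x) *ᵥ C.e i x v)) ∧
      (∀ x : M, Module.finrank ℝ (Submodule.span ℝ
        {v : GaugeGravity.Tan x | ∃ X ∈ C.restrictedDiff Λ, X x = v}) ≤ 3) := by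
  let C := GaugeGravity.coframe hP H hH hμ
  let Γ₂ := (LinearEquiv.ofBijective _ (GaugeGravity.bijective_pseudoOfVectorField hP H hH)).symm
  have hζ : ∀ ζ : GaugeGravity.pseudoTranslations P, ∀ i, ∀ x ∈ P.U i,
      (ζ : ι → M → Fin 3 → ℝ) i x = H.θ i x (Γ₂ ζ x) := by
    intro ζ i x hx
    rw [← GaugeGravity.pseudoOfVectorField_apply hP H (Γ₂ ζ) hx]
    exact congrArg (fun z : GaugeGravity.pseudoTranslations P => (z : ι → M → Fin 3 → ℝ) i x)
      ((LinearEquiv.ofBijective _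
        (GaugeGravity.bijective_pseudoOfVectorField hP H hH)).apply_symm_apply ζ).symm
  refine ⟨GaugeGravity.su2ToSO3, Γ₂, Diffeomorph.refl _ M ∞, C, GaugeGravity.bundleMap P,
    GaugeGravity.su2ToSO3_surjective, GaugeGravity.su2_conj_tau, rfl, rfl, fun _ _ _ _ => rfl,
    fun _ => rfl, fun i x hx u v => C.metric_eq hx u v, fun x u hu => C.metric_pos hu,
    GaugeGravity.continuous_bundleMap, fun _ => rfl, GaugeGravity.bundleMap_act,
    fun i p _ => GaugeGravity.coord_bundleMap i p,
    fun i x _ v => ⟨rfl, GaugeGravity.θ_eq hP H hH hμ v⟩,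
    fun i x hx u v => ⟨GaugeGravity.toSpin_compL_K hP H hH hμ hΛ hx u v,
      GaugeGravity.compQ_K_eq_T hP H hH hμ hx u v⟩,
    fun i x hx u v w =>
      GaugeGravity.chernSimons_eq_einsteinHilbert hP H hH hμ hm hκ hΛ hG hx u v w,
    fun i j x hx u v w => C.einsteinHilbert_glue Λ hx u v w,
    fun i α hα x hx v => ?_, fun ζ i x hx => ?_, fun ζ => ?_, fun x => ?_⟩
  · have hαd := (hα.contMDiffAt ((P.isOpen_U i).mem_nhds hx)).mdifferentiableAt (by simp)
    rw [GaugeGravity.gaugeVar_toL H hx hαd, GaugeGravity.compL_toL_add_toQ,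
      GaugeGravity.compQ_toL_add_toQ, GaugeGravity.gaugeVar_spin hP H hH hμ hαd]
    refine ⟨rfl, ?_⟩
    rw [GaugeGravity.toSpin_mulVec, cross_anticomm, GaugeGravity.θ_eq hP H hH hμ, map_smul]
    rfl
  · rw [hζ ζ i x hx]
    exact GaugeGravity.θ_eq hP H hH hμ _
  · refine forall_congr' fun i => forall_congr' fun x => forall_congr' fun hx =>
      forall_congr' fun v => ?_
    have hX := (GaugeGravity.contDiffAt_coordField (Γ₂ ζ) x).of_le
      (m := 1) (by norm_cast)
    have h1 := GaugeGravity.lieDeriv_spin_sub hP H hH hμ hΛ hx hX (hζ ζ i) v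
    have h2 := GaugeGravity.lieDeriv_e_sub hP H hH hμ hx hX (hζ ζ i) v
    refine and_congr ?_ ?_
    · exact (iff_of_eq (congrArg (· = 0) h1.symm)).trans sub_eq_zero
    · exact (iff_of_eq (congrArg (· = 0) h2.symm)).trans sub_eq_zero
  · exact (Submodule.finrank_le _).trans (GaugeGravity.finrank_tan x).le
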